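/- **Model.** For $\Lambda=[-K,K']\cap\mathbb Z$ with $K,K'\ge 0$, let $$H=\sum_{i=-K}^{K'}h_iS^z_i+\sum_{i=-K}^{K'}\gamma\Gamma_iS^x_i+\sum_{i=-K-1}^{K'}J_iS^z_iS^z_{i+1}$$ act on $\bigotimes_{i\in\Lambda}\mathbb C^2$ ($S^x_i,S^z_i$ Pauli matrices, $S^z_i=1$ for $i\notin\Lambda$). The random variables $h_i,\Gamma_i,J_i$ ($i\in\mathbb Z$) are independent, bounded by $1$, with probability densities bounded by $\rho_0$. Put $\varepsilon=\gamma^{1/20}$, $L_k=(15/8)^k$, $d_m=\exp(L_{m+m_0}^{1/2})$, with a fixed integer $m_0>0$. Basis vectors are labeled by $\sigma\in\{-1,1\}^\Lambda$ ($\sigma_i=1$ off $\Lambda$), $\sigma^{(i)}$ is $\sigma$ flipped at $i$, $E(\sigma)$ is the diagonal entry of $H$, and $H_0$ is the diagonal part of $H$. LLA$(\nu,C)$ (with $\nu>0$) says that in every box of $n$ sites $P(\min_{\alpha\ne\beta}|E_\alpha-E_\beta|<\delta)\le\delta^\nu C^n$ for all $\delta>0$, where the $E_\alpha$ are the eigenvalues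 of $H$ counted with multiplicity. **Step 1.** A site $i\in\Lambda$ is resonant if $|E(\sigma)-E(\sigma^{(i)})|<\varepsilon$ for some $\sigma$; $\mathcal S_1$ is the set of resonant sites. The small blocks $b^{(1)}$ are the nearest-neighbor components of $\mathcal S_1$ of diameter $<L_1$ at distance $>d_1$ from the rest of $\mathcal S_1$; $\mathcal S_{1'}$ is $\mathcal S_1$ without the small blocks. A bar denotes addition of a collar of one site (in $\Lambda$), and $\bar{\bar b}^{(1)}$ is $\bar b^{(1)}$ with one more such collar. Let $J(i)=\gamma\Gamma_iS^x_i$; for $i\notin\mathcal S_1$ let $A(i)_{\sigma\sigma^{(i)}}=\gamma\Gamma_i/(E(\sigma)-E(\sigma^{(i)}))$, all other entries being $0$; $A=\sum_{i\in\Lambda\setminus\mathcal S_1}A(i)$ and $\Omega^{(1)}=e^{-A}$. Expand $$e^AHe^{-A}-H_0=\sum_{i_0\in\mathcal S_1}\sum_{n\ge0}\tfrac1{n!}(\mathrm{ad}\,A)^nJ(i_0)+\sum_{i_0\notin\mathcal S_1}\sum_{n\ge1}\tfrac n{(n+1)!}(\mathrm{ad}\,A)^nJ(i_0)$$ into ordered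 products of one factor $J(i_0)$ and $n$ factors $A(i_p)$, coming from nested commutators $(\mathrm{ad}\,A(i_n))\cdots(\mathrm{ad}\,A(i_1))J(i_0)$ for sequences in which each $i_p$ is within distance $1$ of $\{i_0,\dots,i_{p-1}\}$, like terms being gathered. Each ordered product is a graph $g$ of length $|g|=n+1$; $J^{(1)}(g)$ is its term with its coefficient. $J^{(1)\mathrm{sint}}$ is the sum of the terms of graphs that meet $\mathcal S_1$ and whose sites lie in some $\bar b^{(1)}$. A graph is external if it does not meet $\mathcal S_1$ or is not contained in $\bar{\mathcal S}_1$. $O^{(1)}=\prod_bO_b$ is a product over the small blocks $b^{(1)}$ of orthogonal matrices $O_b$, each changing only the spins in $\bar b^{(1)}$ and depending only on those in $\bar{\bar b}^{(1)}$, that diagonalize $H_0$ plus the part of $J^{(1)\mathrm{sint}}$ in $\bar b^{(1)}$. $E^{(1')}_\sigma$ are the diagonal entries of $O^{(1)\mathrm{tr}}(H_0+J^{(1)\mathrm{sint}})O^{(1)}$. **Step 2.** A graph $g$ touches $b^{(1)}$ if it has a flip in $\bar{\bar b}^{(1)}$; the support of $g$ is the union of its sites and of the $\bar b^{(1)}$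 for the blocks it touches; $O_g$ is the product of $O_b$ over the touched blocks, and $J^{(1')}(g)=O_g^{\mathrm{tr}}J^{(1)}(g)O_g$. $I(g)$ is the smallest interval containing the sites of $g$ and the $\bar{\bar b}^{(1)}$ it touches; $|I(g)|$ is the number of blocks $\bar{\bar b}^{(1)}$ in it plus the number of its other sites. Consider external $g$ with $2\le|g|\le3$ and support disjoint from $\mathcal S_{1'}$, and configurations $\alpha\ne\beta$, $\sigma$, where $\tilde\sigma$ is obtained from $\sigma$ by the flips of $g$ and $\alpha=\sigma$, $\beta=\tilde\sigma$ outside the touched $\bar b^{(1)}$. Such a $(g,\alpha,\sigma,\beta)$ is resonant if $|E^{(1')}_\alpha-E^{(1')}_\beta|<\varepsilon^{|g|}$, or if $|I(g)|\ge\frac78|g|$ and $$\left|\frac{(O_g)_{\sigma\alpha}J^{(1)}(g)_{\sigma\tilde\sigma}(O_g)_{\tilde\sigma\beta}}{E^{(1')}_\alpha-E^{(1')}_\beta}\right|>\frac{(\gamma/\varepsilon)^{|g|}}{((|g|-1)!)^{2/9}}.$$ Let $B^{(2)}$ be the union of the supports of the $g$ that are resonant for some $\alpha,\sigma,\beta$.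 Starting from $\mathcal S_1\cup B^{(2)}$, successively for $m=1,2,3$ remove, among the components for connections of length $\le d_m$ of what remains, those of diameter $<L_2$ and size $<L_m$. Here the size of a $b^{(1)}$ disjoint from $B^{(2)}$ is its number of sites; otherwise the size is the number of sites outside all $\bar b^{(1)}$ plus the number of $\bar b^{(1)}$ met, but at least $2$. The removed sets that are not step 1 small blocks disjoint from $B^{(2)}$ are the small blocks $b^{(2)}$; $\mathcal S_2$ is the union of the $b^{(2)}$ and of what finally remains. Let $|x-y|^{(1)}$ be the distance with each $\bar{\bar b}^{(1)}$ contracted to a point; $\bar b^{(2)}$ is $b^{(2)}$ with a collar of three steps, and $\bar{\bar b}^{(2)}$ is $\bar b^{(2)}$ with a further collar of two steps, in this distance. Let $$A^{(2)}(g)_{\alpha\beta}=\frac{J^{(1')}(g)_{\alpha\beta}}{E^{(1')}_\alpha-E^{(1')}_\beta}\quad(\alpha\ne\beta),\qquad A^{(2)}(g)_{\alpha\alpha}=0 ,$$ let $A^{(2)}$ be the sum of $A^{(2)}(g)$ over external $g$ with $2\le|g|\le3$ and support disjoint from $\mathcal S_2$, and $\Omega^{(2)}=e^{-A^{(2)}}$.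 The part of $J^{(2)\mathrm{sint}}$ in a block $b^{(2)}$ is $\sum_{n\ge0}\frac1{n!}(\mathrm{ad}\,A')^nJ'$, where $A'$ is the sum of those $A^{(2)}(g)$ whose support is contained in $\bar b^{(2)}$ and $J'$ is the sum of $J^{(1')}(g)$ over all $g$ not in $J^{(1)\mathrm{sint}}$ whose support meets $\mathcal S_2$ and is contained in $\bar b^{(2)}$. In addition $J^{(2)\mathrm{sint}}$ contains the diagonal parts of $J^{(1')}(g)$ for external $g$ with $|g|=2$ and support disjoint from $\mathcal S_2$. $O^{(2)}$ is a product over the small blocks $b^{(2)}$ of orthogonal matrices, each changing only the spins in $\bar b^{(2)}$ and depending only on those in $\bar{\bar b}^{(2)}$, that diagonalize the diagonal matrix of the $E^{(1')}_\sigma$, plus these diagonal parts, plus the part of $J^{(2)\mathrm{sint}}$ in the block. Finally $$R^{(2')}=\Omega^{(1)}O^{(1)}\Omega^{(2)}O^{(2)} .$$ **Proposition 3.2.** Let $\rho_0$, $\nu>0$, $C$, $m_0$ be given. There are constants $c$ and $\gamma_0>0$, depending on these only, such that the following holds for all $0<\gamma<\gamma_0$ and all disorder distributions as above satisfying LLA$(\nu,C)$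 (at this $\gamma$), for every box $\Lambda$ and every choice of the rotations $O^{(1)},O^{(2)}$ for which $R^{(2')}$ is measurable in the disorder: $$\Big|\,\mathbb E\,\mathrm{Av}_\alpha\Big|\sum_{\sigma,\tilde\sigma}R^{(2')\mathrm{tr}}_{\alpha\sigma}(S^z_0)_{\sigma\tilde\sigma}R^{(2')}_{\tilde\sigma\alpha}\Big|-1\Big|\le c\,\varepsilon ,$$ the random variable under $\mathbb E$ being integrable. Here $\mathrm{Av}_\alpha$ is the average over the $2^{|\Lambda|}$ labels $\alpha$ with uniform weights or, more generally, with any measurable nonnegative weights of sum $1$, which may depend on the disorder (in particular on the energies). -/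

import Mathlib

open MeasureTheory ProbabilityTheory
open scoped Matrix

noncomputable section

namespace SpinChain

/-! ## The model -/

/-- The box `[-left, right] ∩ ℤ`; it always contains the site `0`. -/
structure Box where
  left : ℕ
  right : ℕ

/-- The sites of the box. -/
def Box.sites (Λ : Box) : Finset ℤ := Finset.Icc (-(Λ.left : ℤ)) (Λ.right : ℤ)

/-- Spin configurations in the box; they index the tensor product basis. -/
abbrev Config (Λ : Box) : Type := Λ.sites → ℤˣ

/-- Operators, as matrices in the tensor product basis (all matrices that occur are real). -/
abbrev Op (Λ : Box) : Type := Matrix (Config Λ) (Config Λ) ℝ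

/-- The coupling `γ` of the transverse term and one realization of the disorder. -/
structure Couplings where
  γ : ℝ
  h : ℤ → ℝ
  Γ : ℤ → ℝ
  J : ℤ → ℝ

/-- The resonance cutoff `ε = γ^(1/20)`. -/
def Couplings.ε (c : Couplings) : ℝ := c.γ ^ (1 / 20 : ℝ)

/-- The value `±1` of the spin at `i`, frozen to `+1` outside the box. -/
def spin {Λ : Box} (σ : Config Λ) (i : ℤ) : ℝ :=
  if hi : i ∈ Λ.sites then (((σ ⟨i, hi⟩ : ℤˣ) : ℤ) : ℝ) else 1

/-- The configuration with the spin at `i` flipped. -/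
def flip {Λ : Box} (σ : Config Λ) (i : ℤ) : Config Λ :=
  fun j => if (j : ℤ) = i then -σ j else σ j

/-- The Pauli matrix `S^z` at site `i`; it is the identity for `i` outside the box. -/
def Sz (Λ : Box) (i : ℤ) : Op Λ := Matrix.diagonal fun σ => spin σ i

/-- The Pauli matrix `S^x` at a site `i` of the box. -/
def Sx (Λ : Box) (i : ℤ) : Op Λ := fun σ τ => if τ = flip σ i then 1 else 0

/-- The Hamiltonian in the box, with `+` boundary conditions. -/
def hamiltonian (c : Couplings) (Λ : Box) : Op Λ :=
  ∑ i ∈ Λ.sites, c.h i • Sz Λ i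
    + ∑ i ∈ Λ.sites, (c.γ * c.Γ i) • Sx Λ i
    + ∑ i ∈ Finset.Icc (-(Λ.left : ℤ) - 1) (Λ.right : ℤ), c.J i • (Sz Λ i * Sz Λ (i + 1))

theorem flip_flip {Λ : Box} (σ : Config Λ) (i : ℤ) : flip (flip σ i) i = σ := by
  funext j
  by_cases hj : (j : ℤ) = i <;> simp [flip, hj]

theorem Sz_isHermitian (Λ : Box) (i : ℤ) : (Sz Λ i).IsHermitian := by
  simp [Matrix.IsHermitian, Sz]

theorem Sx_isHermitian (Λ : Box) (i : ℤ) : (Sx Λ i).IsHermitian := by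
  ext σ τ
  have : (σ = flip τ i) ↔ (τ = flip σ i) := by
    constructor <;> · rintro rfl; exact (flip_flip _ i).symm
  simp [Sx, this]

theorem hamiltonian_isHermitian (c : Couplings) (Λ : Box) : (hamiltonian c Λ).IsHermitian := by
  have hsmul : ∀ (r : ℝ) (M : Op Λ), M.IsHermitian → (r • M).IsHermitian := by
    intro r M hM
    rw [Matrix.IsHermitian, Matrix.conjTranspose_smul, hM.eq, star_trivial]
  have hsum : ∀ (s : Finset ℤ) (f : ℤ → Op Λ), (∀ i, (f i).IsHermitian) →
      (∑ i ∈ s, f i).IsHermitian := by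
    intro s f hf
    simp only [Matrix.IsHermitian, Matrix.conjTranspose_sum]
    exact Finset.sum_congr rfl fun i _ => (hf i).eq
  refine ((hsum _ _ fun i => hsmul _ _ (Sz_isHermitian Λ i)).add
    (hsum _ _ fun i => hsmul _ _ (Sx_isHermitian Λ i))).add (hsum _ _ fun i => hsmul _ _ ?_)
  simp [Matrix.IsHermitian, Sz, Matrix.diagonal_mul_diagonal]

/-- The diagonal entry `E(σ)` of the Hamiltonian. -/
def energy (c : Couplings) {Λ : Box} (σ : Config Λ) : ℝ :=
  ∑ i ∈ Λ.sites, c.h i * spin σ i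
    + ∑ i ∈ Finset.Icc (-(Λ.left : ℤ) - 1) (Λ.right : ℤ), c.J i * spin σ i * spin σ (i + 1)

/-! ## The disorder -/

/-- The random fields, random transverse fields and random exchange couplings, on all of `ℤ`. -/
structure RandomCouplings (Ω : Type*) where
  h : ℤ → Ω → ℝ
  Γ : ℤ → Ω → ℝ
  J : ℤ → Ω → ℝ

/-- All the random variables as a single family. -/
def RandomCouplings.family {Ω : Type*} (V : RandomCouplings Ω) (p : Fin 3 × ℤ) : Ω → ℝ :=
  ![V.h, V.Γ, V.J] p.1 p.2

/-- The realization at the sample point `ω`. -/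
def RandomCouplings.at {Ω : Type*} (V : RandomCouplings Ω) (γ : ℝ) (ω : Ω) : Couplings where
  γ := γ
  h := fun i => V.h i ω
  Γ := fun i => V.Γ i ω
  J := fun i => V.J i ω

/-- The standing assumptions on the disorder: all the variables are independent, bounded by `1`,
and have probability densities bounded by `ρ₀`. -/
structure IsDisorder {Ω : Type*} [MeasurableSpace Ω] (μ : Measure Ω) (ρ₀ : ℝ)
    (V : RandomCouplings Ω) : Prop where
  measurable : ∀ p, Measurable (V.family p)
  indep : iIndepFun V.family μ
  bounded : ∀ p, ∀ᵐ ω ∂μ, |V.family p ω| ≤ 1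
  density : ∀ p, ∃ f : ℝ → ENNReal, Measurable f ∧ (∀ x, f x ≤ ENNReal.ofReal ρ₀) ∧
    μ.map (V.family p) = volume.withDensity f

/-- Limited level attraction with exponent `ν` and constant `C`: in every box of `n` sites, the
probability that two eigenvalues of the Hamiltonian (counted with multiplicity) are closer
than `δ` is at most `δ^ν C^n`. -/
def LLA {Ω : Type*} [MeasurableSpace Ω] (μ : Measure Ω) (V : RandomCouplings Ω)
    (γ ν C : ℝ) : Prop :=
  ∀ (Λ : Box) (δ : ℝ), 0 < δ →
    μ {ω | ∃ α β, α ≠ β ∧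
      |(hamiltonian_isHermitian (V.at γ ω) Λ).eigenvalues α
        - (hamiltonian_isHermitian (V.at γ ω) Λ).eigenvalues β| < δ}
      ≤ ENNReal.ofReal (δ ^ ν * C ^ Λ.sites.card)

/-! ## Length scales, components, collars -/

/-- The length scales `L_k = (15/8)^k`. -/
def lengthScale (k : ℕ) : ℝ := (15 / 8 : ℝ) ^ k

/-- The separation distances `d_m = exp (L_{m + m₀}^(1/2))`. -/
def sepDist (m₀ m : ℕ) : ℝ := Real.exp (Real.sqrt (lengthScale (m + m₀)))

open Classical in
/-- The connected components of `T` for proximity connections of length at most `d`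
(`d = 1`: nearest-neighbor connections). -/
def components (d : ℝ) (T : Finset ℤ) : Finset (Finset ℤ) :=
  T.image fun x => T.filter fun y =>
    Relation.ReflTransGen (fun a b : ℤ => b ∈ T ∧ ((|a - b| : ℤ) : ℝ) ≤ d) x y

/-- The diameter of `X` is less than `d`. -/
def DiamLT (X : Finset ℤ) (d : ℝ) : Prop := ∀ x ∈ X, ∀ y ∈ X, ((|x - y| : ℤ) : ℝ) < d

open Classical in
/-- `X` together with its collar of `k` steps inside the box. -/
def collar (Λ : Box) (k : ℕ) (X : Finset ℤ) : Finset ℤ :=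
  Λ.sites.filter fun x => ∃ y ∈ X, |x - y| ≤ (k : ℤ)

/-! ## Step 1: resonant sites, small blocks -/

/-- Site `i` is resonant: for some choice of the spins, flipping the spin at `i` changes the
energy by less than `ε`. -/
def IsResonantSite (c : Couplings) (Λ : Box) (i : ℤ) : Prop :=
  ∃ σ : Config Λ, |energy c σ - energy c (flip σ i)| < c.ε

open Classical in
/-- The resonant set `𝒮₁`. -/
def S1 (c : Couplings) (Λ : Box) : Finset ℤ := Λ.sites.filter fun i => IsResonantSite c Λ i

open Classical in
/-- The small blocks `b⁽¹⁾`: the resonant blocks of diameter `< L₁` (that is, `0` or `1`) which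
are at distance `> d₁` from the other resonant blocks. -/
def small1 (m₀ : ℕ) (c : Couplings) (Λ : Box) : Finset (Finset ℤ) :=
  (components 1 (S1 c Λ)).filter fun b =>
    DiamLT b (lengthScale 1) ∧
      ∀ x ∈ b, ∀ y ∈ S1 c Λ \ b, sepDist m₀ 1 < ((|x - y| : ℤ) : ℝ)

/-- The collared small block `b̄⁽¹⁾`. -/
def bar1 (Λ : Box) (b : Finset ℤ) : Finset ℤ := collar Λ 1 b

/-- The small block with its second collar. -/
def barbar1 (Λ : Box) (b : Finset ℤ) : Finset ℤ := collar Λ 1 (bar1 Λ b)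

/-- The large block region `𝒮_{1'}` (without collar). -/
def S1large (m₀ : ℕ) (c : Couplings) (Λ : Box) : Finset ℤ :=
  S1 c Λ \ (small1 m₀ c Λ).biUnion id

/-- The collared resonant region. -/
def S1bar (c : Couplings) (Λ : Box) : Finset ℤ := collar Λ 1 (S1 c Λ)

/-! ## Step 1: generator, graphs -/

/-- The local interaction `J⁽⁰⁾(i) = γ_i S^x_i`. -/
def J0 (c : Couplings) (Λ : Box) (i : ℤ) : Op Λ := (c.γ * c.Γ i) • Sx Λ i

/-- The local generator `A(i)`, for `i ∉ 𝒮₁`. -/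
def A1 (c : Couplings) (Λ : Box) (i : ℤ) : Op Λ :=
  fun σ τ => if τ = flip σ i then c.γ * c.Γ i / (energy c σ - energy c τ) else 0

/-- The first basis change `Ω = exp (-A)`, `A = ∑_{i ∉ 𝒮₁} A(i)`. -/
def Omega1 (c : Couplings) (Λ : Box) : Op Λ :=
  NormedSpace.exp (-∑ i ∈ Λ.sites \ S1 c Λ, A1 c Λ i)

/-- An ordered product `A(l_a) ⋯ A(l_1) J⁽⁰⁾(center) A(r_1) ⋯ A(r_b)`, as obtained by expanding
the multiple commutators of `A` with `J⁽⁰⁾`. The lists `[l_1, …, l_a]` and `[r_1, …, r_b]` are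
read outwards from the center. -/
structure Word where
  outL : List ℤ
  center : ℤ
  outR : List ℤ

namespace Word

/-- The number `n` of commutators. -/
def order (w : Word) : ℕ := w.outL.length + w.outR.length

/-- The length `|g| = n + 1`, the number of operators in the product. -/
def length (w : Word) : ℕ := w.order + 1

/-- The sites at which the spin is flipped. -/
def sites (w : Word) : Finset ℤ := (w.outL ++ w.center :: w.outR).toFinset

/-- The configuration reached from `σ` by performing all the flips. -/
def walk {Λ : Box} (w : Word) (σ : Config Λ) : Config Λ :=
  (w.outL ++ w.center :: w.outR).foldl flip σ

end Word

open Classical in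
/-- The number of ways to interleave the two lists into a sequence `i_1, …, i_n` which is
admissible, meaning that each `i_p` is within distance `1` of the sites visited before it. -/
def interleavings (visited : Finset ℤ) : List ℤ → List ℤ → ℕ
  | [], [] => 1
  | l :: ls, [] =>
      if ∃ v ∈ visited, |l - v| ≤ 1 then interleavings (insert l visited) ls [] else 0
  | [], r :: rs =>
      if ∃ v ∈ visited, |r - v| ≤ 1 then interleavings (insert r visited) [] rs else 0
  | l :: ls, r :: rs =>
      (if ∃ v ∈ visited, |l - v| ≤ 1 then interleavings (insert l visited) ls (r :: rs) else 0)
        + (if ∃ v ∈ visited, |r - v| ≤ 1 then interleavings (insert r visited) (l :: ls) rs else 0)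
termination_by ls rs => ls.length + rs.length

/-- The number of admissible sequences `i_0, i_1, …, i_n` whose nested commutator contains the
given ordered product; it is the binomial coefficient `n choose b` if the order in which the
factors on the left and on the right are produced is not constrained by admissibility. -/
def Word.multiplicity (w : Word) : ℕ := interleavings {w.center} w.outL w.outR

/-- The graphs `g₁` of the interaction after the first basis change: ordered products that arise
from an admissible sequence, with all the sites of `A` factors nonresonant. Products of a single
factor are the terms of `J⁽⁰⁾ʳᵉˢ`. -/
def IsGraph (c : Couplings) (Λ : Box) (w : Word) : Prop :=
  w.sites ⊆ Λ.sites ∧ (∀ i ∈ w.outL ++ w.outR, i ∉ S1 c Λ) ∧ w.multiplicity ≠ 0 ∧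
    (w.order = 0 → w.center ∈ S1 c Λ)

open Classical in
/-- The term of `J⁽⁰⁾ʳᵉˢ + J⁽¹⁾` given by the graph `w`, the coefficients being those of
`∑_n (n/(n+1)!) (ad A)^n J⁽⁰⁾ᵖᵉʳ + ∑_n (1/n!) (ad A)^n J⁽⁰⁾ʳᵉˢ`. -/
def graphTerm (c : Couplings) (Λ : Box) (w : Word) : Op Λ :=
  ((w.multiplicity : ℝ) * (-1) ^ w.outR.length *
      (if w.center ∈ S1 c Λ then 1 / (w.order.factorial : ℝ)
        else (w.order : ℝ) / ((w.order + 1).factorial : ℝ))) •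
    ((w.outL.reverse.map (A1 c Λ)).prod * J0 c Λ w.center * (w.outR.map (A1 c Λ)).prod)

/-- The graphs of `J⁽¹⁾ˢⁱⁿᵗ` in the small block `b`: they intersect `𝒮₁` and are contained
in `b̄`. -/
def IsSmallInternal (c : Couplings) (Λ : Box) (b : Finset ℤ) (w : Word) : Prop :=
  IsGraph c Λ w ∧ ¬Disjoint w.sites (S1 c Λ) ∧ w.sites ⊆ bar1 Λ b

/-- The graphs of `J⁽¹⁾ᵉˣᵗ`: they do not intersect `𝒮₁` or are not contained in its collared
version. -/
def IsExternal (c : Couplings) (Λ : Box) (w : Word) : Prop :=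
  IsGraph c Λ w ∧ (Disjoint w.sites (S1 c Λ) ∨ ¬w.sites ⊆ S1bar c Λ)

open Classical in
/-- The part of `J⁽¹⁾ˢⁱⁿᵗ` in the small block `b`. -/
def J1sint (c : Couplings) (Λ : Box) (b : Finset ℤ) : Op Λ :=
  ∑' w : Word, if IsSmallInternal c Λ b w then graphTerm c Λ w else 0

/-! ## Block rotations -/

/-- `U` is an orthogonal matrix which diagonalizes `M`, acts on the spins in `X` only, and depends
on the spins in `Y` only. -/
structure IsBlockRotation {Λ : Box} (X Y : Finset ℤ) (M U : Op Λ) : Prop where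
  orthogonal : Uᵀ * U = 1
  acts : ∀ σ τ, U σ τ ≠ 0 → ∀ i : Λ.sites, (i : ℤ) ∉ X → σ i = τ i
  depends : ∀ σ τ σ' τ' : Config Λ,
    (∀ i : Λ.sites, (i : ℤ) ∈ Y → σ i = σ' i ∧ τ i = τ' i) →
    (∀ i : Λ.sites, (i : ℤ) ∉ X → σ i = τ i) → (∀ i : Λ.sites, (i : ℤ) ∉ X → σ' i = τ' i) →
    U σ τ = U σ' τ'
  diagonalizes : (Uᵀ * M * U).IsDiag

/-- `U b`, for the step 1 small blocks `b`, are block rotations which diagonalize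
`H₀ + J⁽¹⁾ˢⁱⁿᵗ` within the blocks. The choice of eigenvectors and their labeling are free. -/
def IsStep1Rotation (m₀ : ℕ) (c : Couplings) (Λ : Box) (U : Finset ℤ → Op Λ) : Prop :=
  ∀ b ∈ small1 m₀ c Λ, IsBlockRotation (bar1 Λ b) (barbar1 Λ b)
    (Matrix.diagonal (energy c) + J1sint c Λ b) (U b)

/-- The product of the block rotations of a family of blocks. The factors belong to
different tensor factors and commute, so that their order does not matter. -/
def blockProduct {Λ : Box} (B : Finset (Finset ℤ)) (U : Finset ℤ → Op Λ) : Op Λ :=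
  (B.toList.map U).prod

/-- The rotation `O⁽¹⁾`. -/
def O1 (m₀ : ℕ) (c : Couplings) (Λ : Box) (U : Finset ℤ → Op Λ) : Op Λ :=
  blockProduct (small1 m₀ c Λ) U

/-- The energies `E⁽¹'⁾`: the diagonal entries of
`H₀⁽¹'⁾ = O⁽¹⁾ᵗʳ (H₀ + J⁽¹⁾ˢⁱⁿᵗ) O⁽¹⁾`. -/
def energy1 (m₀ : ℕ) (c : Couplings) (Λ : Box) (U : Finset ℤ → Op Λ) (σ : Config Λ) : ℝ :=
  let H₀ : Op Λ := (O1 m₀ c Λ U)ᵀ *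
    (Matrix.diagonal (energy c) + ∑ b ∈ small1 m₀ c Λ, J1sint c Λ b) * O1 m₀ c Λ U
  H₀ σ σ

/-! ## Step 2: rotated graphs and resonances -/

open Classical in
/-- The small blocks touched by a graph: those with a flip of the graph in the twice collared
block. Conjugation with the rotations of the other blocks leaves the graph unchanged. -/
def touched (m₀ : ℕ) (c : Couplings) (Λ : Box) (w : Word) : Finset (Finset ℤ) :=
  (small1 m₀ c Λ).filter fun b => ¬Disjoint w.sites (barbar1 Λ b)

/-- The sites in the touched collared blocks `b̄⁽¹⁾`. -/
def touchedSites (m₀ : ℕ) (c : Couplings) (Λ : Box) (w : Word) : Finset ℤ :=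
  (touched m₀ c Λ w).biUnion (bar1 Λ)

/-- The sites and blocks that belong to the graph, as a set of sites. -/
def support (m₀ : ℕ) (c : Couplings) (Λ : Box) (w : Word) : Finset ℤ :=
  w.sites ∪ touchedSites m₀ c Λ w

/-- The rotations of the touched blocks. -/
def touchedRotation (m₀ : ℕ) (c : Couplings) (Λ : Box) (U : Finset ℤ → Op Λ) (w : Word) : Op Λ :=
  blockProduct (touched m₀ c Λ w) U

/-- The rotated term `O⁽¹⁾ᵗʳ J⁽¹⁾(w) O⁽¹⁾`. -/
def rotatedTerm (m₀ : ℕ) (c : Couplings) (Λ : Box) (U : Finset ℤ → Op Λ) (w : Word) : Op Λ :=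
  (touchedRotation m₀ c Λ U w)ᵀ * graphTerm c Λ w * touchedRotation m₀ c Λ U w

open Classical in
/-- The smallest interval covering the sites and twice collared blocks that contain flips of
the graph. -/
def graphInterval (m₀ : ℕ) (c : Couplings) (Λ : Box) (w : Word) : Finset ℤ :=
  Λ.sites.filter fun x =>
    (∃ y ∈ w.sites ∪ (touched m₀ c Λ w).biUnion (barbar1 Λ), y ≤ x) ∧
      ∃ y ∈ w.sites ∪ (touched m₀ c Λ w).biUnion (barbar1 Λ), x ≤ y

open Classical in
/-- The number of twice collared blocks in the interval of the graph plus the number of its sites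
not in such blocks. -/
def graphSpan (m₀ : ℕ) (c : Couplings) (Λ : Box) (w : Word) : ℕ :=
  ((graphInterval m₀ c Λ w).filter fun x => ∀ b ∈ small1 m₀ c Λ, x ∉ barbar1 Λ b).card
    + ((small1 m₀ c Λ).filter fun b => ¬Disjoint (barbar1 Λ b) (graphInterval m₀ c Λ w)).card

/-- A rotated graph `g_{1'} : α → β` is given by the graph `w`, the labels `α`, `β` and the
intermediate configurations `σ` and `w.walk σ`; `α`, `β` agree with these outside the touched
blocks. It is resonant in step 2 if it is off-diagonal, of length `2` or `3`, does not meet the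
large blocks of step 1, and satisfies one of the resonance conditions I, II. -/
def IsResonantGraph (m₀ : ℕ) (c : Couplings) (Λ : Box) (U : Finset ℤ → Op Λ) (w : Word)
    (α σ β : Config Λ) : Prop :=
  IsExternal c Λ w ∧ 2 ≤ w.length ∧ w.length ≤ 3 ∧
    Disjoint (support m₀ c Λ w) (S1large m₀ c Λ) ∧
    (∀ i : Λ.sites, (i : ℤ) ∉ touchedSites m₀ c Λ w → α i = σ i ∧ β i = w.walk σ i) ∧
    α ≠ β ∧
    (|energy1 m₀ c Λ U α - energy1 m₀ c Λ U β| < c.ε ^ w.length ∨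
      (|touchedRotation m₀ c Λ U w σ α * graphTerm c Λ w σ (w.walk σ)
            * touchedRotation m₀ c Λ U w (w.walk σ) β
          / (energy1 m₀ c Λ U α - energy1 m₀ c Λ U β)|
          > (c.γ / c.ε) ^ w.length / ((w.length - 1).factorial : ℝ) ^ (2 / 9 : ℝ) ∧
        (7 / 8 : ℝ) * w.length ≤ graphSpan m₀ c Λ w))

open Classical in
/-- The union of the step 2 resonant blocks `B⁽²⁾`. -/
def resonant2 (m₀ : ℕ) (c : Couplings) (Λ : Box) (U : Finset ℤ → Op Λ) : Finset ℤ :=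
  Λ.sites.filter fun x =>
    ∃ w, (∃ α σ β, IsResonantGraph m₀ c Λ U w α σ β) ∧ x ∈ support m₀ c Λ w

/-! ## Step 2: reorganization of the resonant region -/

/-- `X` is a step 1 small block which is not part of a step 2 resonant block. -/
def IsOldBlock (m₀ : ℕ) (c : Couplings) (Λ : Box) (U : Finset ℤ → Op Λ) (X : Finset ℤ) : Prop :=
  X ∈ small1 m₀ c Λ ∧ Disjoint X (resonant2 m₀ c Λ U)

open Classical in
/-- The size of a block: the number of its sites for a block `b⁽¹⁾`, otherwise the number of
sites and blocks `b̄⁽¹⁾` in it, but at least `2`. -/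
def blockSize (m₀ : ℕ) (c : Couplings) (Λ : Box) (U : Finset ℤ → Op Λ) (X : Finset ℤ) : ℕ :=
  if IsOldBlock m₀ c Λ U X then X.card
  else max 2 ((X \ (small1 m₀ c Λ).biUnion (bar1 Λ)).card
    + ((small1 m₀ c Λ).filter fun b => ¬Disjoint (bar1 Λ b) X).card)

open Classical in
/-- The small blocks of size `< L_m` and diameter `< L₂` among the components of `T` for proximity
connections on the scale `d_m`. -/
def extract (m₀ : ℕ) (c : Couplings) (Λ : Box) (U : Finset ℤ → Op Λ) (m : ℕ) (T : Finset ℤ) :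
    Finset (Finset ℤ) :=
  (components (sepDist m₀ m) T).filter fun X =>
    DiamLT X (lengthScale 2) ∧ (blockSize m₀ c Λ U X : ℝ) < lengthScale m

/-- What remains of the complete resonant region after the small blocks of size `< L_m` have been
extracted, on the successive scales `d_1, …, d_m`. -/
def remaining (m₀ : ℕ) (c : Couplings) (Λ : Box) (U : Finset ℤ → Op Λ) : ℕ → Finset ℤ
  | 0 => S1 c Λ ∪ resonant2 m₀ c Λ U
  | m + 1 => remaining m₀ c Λ U m
      \ (extract m₀ c Λ U (m + 1) (remaining m₀ c Λ U m)).biUnion id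

/-- The large block region `𝒮_{2'}` (without collar). A block of diameter `< L₂` has at most four
sites, and `4 < L₃`, so that there are no further small blocks after the scale `d₃`. -/
def S2large (m₀ : ℕ) (c : Couplings) (Λ : Box) (U : Finset ℤ → Op Λ) : Finset ℤ :=
  remaining m₀ c Λ U 3

open Classical in
/-- The new small blocks `b⁽²⁾`: the extracted blocks other than those kept from step 1. -/
def small2 (m₀ : ℕ) (c : Couplings) (Λ : Box) (U : Finset ℤ → Op Λ) : Finset (Finset ℤ) :=
  ((Finset.range 3).biUnion fun m =>
    extract m₀ c Λ U (m + 1) (remaining m₀ c Λ U m)).filter fun X => ¬IsOldBlock m₀ c Λ U X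

/-- The region `𝒮₂`: the large block region and the small blocks `b⁽²⁾`. -/
def S2 (m₀ : ℕ) (c : Couplings) (Λ : Box) (U : Finset ℤ → Op Λ) : Finset ℤ :=
  S2large m₀ c Λ U ∪ (small2 m₀ c Λ U).biUnion id

open Classical in
/-- The distance `|x - y|⁽¹⁾`, in which the twice collared blocks of step 1 are contracted
to points. -/
def dist1 (m₀ : ℕ) (c : Couplings) (Λ : Box) (x y : ℤ) : ℕ :=
  ((Finset.Ico (min x y) (max x y)).filter fun k =>
    ∀ b ∈ small1 m₀ c Λ, ¬(k ∈ barbar1 Λ b ∧ k + 1 ∈ barbar1 Λ b)).card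

open Classical in
/-- `X` together with its collar of `k` steps, measured in `|x - y|⁽¹⁾`. -/
def collar1 (m₀ : ℕ) (c : Couplings) (Λ : Box) (k : ℕ) (X : Finset ℤ) : Finset ℤ :=
  Λ.sites.filter fun x => ∃ y ∈ X, dist1 m₀ c Λ x y ≤ k

/-- The collared small block `b̄⁽²⁾`, with a collar of three steps. -/
def bar2 (m₀ : ℕ) (c : Couplings) (Λ : Box) (b : Finset ℤ) : Finset ℤ := collar1 m₀ c Λ 3 b

/-- The small block `b⁽²⁾` with its second collar, of width `15/14 L₁`, that is, two steps. -/
def barbar2 (m₀ : ℕ) (c : Couplings) (Λ : Box) (b : Finset ℤ) : Finset ℤ :=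
  collar1 m₀ c Λ 2 (bar2 m₀ c Λ b)

/-! ## Step 2: generator and rotation -/

/-- The graphs of `J⁽¹'⁾ᵖᵉʳ` (whose off-diagonal entries are used): length `2` or `3` and all
sites and blocks outside `𝒮₂`. -/
def IsPerturbative (m₀ : ℕ) (c : Couplings) (Λ : Box) (U : Finset ℤ → Op Λ) (w : Word) : Prop :=
  IsExternal c Λ w ∧ 2 ≤ w.length ∧ w.length ≤ 3 ∧
    Disjoint (support m₀ c Λ w) (S2 m₀ c Λ U)

/-- The contribution of the graph `w` to the generator `A⁽²⁾`. -/
def A2term (m₀ : ℕ) (c : Couplings) (Λ : Box) (U : Finset ℤ → Op Λ) (w : Word) : Op Λ :=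
  fun α β => if α = β then 0
    else rotatedTerm m₀ c Λ U w α β / (energy1 m₀ c Λ U α - energy1 m₀ c Λ U β)

open Classical in
/-- The generator `A⁽²⁾`. -/
def A2 (m₀ : ℕ) (c : Couplings) (Λ : Box) (U : Finset ℤ → Op Λ) : Op Λ :=
  ∑' w : Word, if IsPerturbative m₀ c Λ U w then A2term m₀ c Λ U w else 0

/-- The basis change `Ω⁽²⁾ = exp (-A⁽²⁾)`. -/
def Omega2 (m₀ : ℕ) (c : Couplings) (Λ : Box) (U : Finset ℤ → Op Λ) : Op Λ :=
  NormedSpace.exp (-A2 m₀ c Λ U)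

open Classical in
/-- The part of `A⁽²⁾` given by graphs contained in `X`. -/
def A2in (m₀ : ℕ) (c : Couplings) (Λ : Box) (U : Finset ℤ → Op Λ) (X : Finset ℤ) : Op Λ :=
  ∑' w : Word, if IsPerturbative m₀ c Λ U w ∧ support m₀ c Λ w ⊆ X then A2term m₀ c Λ U w else 0

open Classical in
/-- The part of `J⁽¹'⁾ʳᵉˢ + J⁽¹⁾ˡⁱⁿᵗ` given by graphs which intersect `𝒮₂` and are contained
in `X`; these are all the terms except those of `J⁽¹⁾ˢⁱⁿᵗ`, already diagonalized in step 1. -/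
def J1in (m₀ : ℕ) (c : Couplings) (Λ : Box) (U : Finset ℤ → Op Λ) (X : Finset ℤ) : Op Λ :=
  ∑' w : Word,
    if IsGraph c Λ w ∧ (∀ b ∈ small1 m₀ c Λ, ¬IsSmallInternal c Λ b w) ∧
        ¬Disjoint (support m₀ c Λ w) (S2 m₀ c Λ U) ∧ support m₀ c Λ w ⊆ X
      then rotatedTerm m₀ c Λ U w else 0

/-- The part of `J⁽²⁾ˢⁱⁿᵗ` in the small block `b⁽²⁾`: the sum of all the terms of
`∑_n (1/n!) (ad A⁽²⁾)^n (J⁽¹'⁾ʳᵉˢ + J⁽¹⁾ˡⁱⁿᵗ)` whose graph intersects `𝒮₂` and is contained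
in `b̄⁽²⁾`. The graphs of `A⁽²⁾` and of `J⁽¹'⁾ᵖᵉʳ` do not intersect `𝒮₂`. -/
def J2sint (m₀ : ℕ) (c : Couplings) (Λ : Box) (U : Finset ℤ → Op Λ) (b : Finset ℤ) : Op Λ :=
  ∑' n : ℕ, (1 / (n.factorial : ℝ)) •
    (fun M : Op Λ => A2in m₀ c Λ U (bar2 m₀ c Λ b) * M - M * A2in m₀ c Λ U (bar2 m₀ c Λ b))^[n]
      (J1in m₀ c Λ U (bar2 m₀ c Λ b))

open Classical in
/-- The second order diagonal terms for sites outside `𝒮₂`, which are part of `J⁽²⁾ˢⁱⁿᵗ`. -/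
def diag2 (m₀ : ℕ) (c : Couplings) (Λ : Box) (U : Finset ℤ → Op Λ) : Op Λ :=
  ∑' w : Word,
    if IsExternal c Λ w ∧ w.length = 2 ∧ Disjoint (support m₀ c Λ w) (S2 m₀ c Λ U)
      then Matrix.diagonal (fun σ => rotatedTerm m₀ c Λ U w σ σ) else 0

/-- `U' b`, for the step 2 small blocks `b`, are block rotations which diagonalize
`H₀⁽¹'⁾ + J⁽²⁾ˢⁱⁿᵗ` within the blocks. -/
def IsStep2Rotation (m₀ : ℕ) (c : Couplings) (Λ : Box) (U U' : Finset ℤ → Op Λ) : Prop :=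
  ∀ b ∈ small2 m₀ c Λ U, IsBlockRotation (bar2 m₀ c Λ b) (barbar2 m₀ c Λ b)
    (Matrix.diagonal (energy1 m₀ c Λ U) + diag2 m₀ c Λ U + J2sint m₀ c Λ U b) (U' b)

/-- The rotation `O⁽²⁾`. -/
def O2 (m₀ : ℕ) (c : Couplings) (Λ : Box) (U U' : Finset ℤ → Op Λ) : Op Λ :=
  blockProduct (small2 m₀ c Λ U) U'

/-- The cumulative rotation `R⁽²'⁾ = Ω⁽¹⁾ O⁽¹⁾ Ω⁽²⁾ O⁽²⁾`, whose columns are the step 2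
approximate eigenvectors. -/
def R2 (m₀ : ℕ) (c : Couplings) (Λ : Box) (U U' : Finset ℤ → Op Λ) : Op Λ :=
  Omega1 c Λ * O1 m₀ c Λ U * Omega2 m₀ c Λ U * O2 m₀ c Λ U U'

/-- The average, with weights `p`, of the modulus of the expectation of `S^z_0` in the columns
of `R`. -/
def averageSz {Λ : Box} (p : Config Λ → ℝ) (R : Op Λ) : ℝ :=
  ∑ α, p α * |(Rᵀ * Sz Λ 0 * R) α α|

end SpinChain

end

/-!
Conjugating `S^z_0` by the orthogonal matrix `exp (-A)` moves it by at most the norm of the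
commutator `[A, S^z_0]`, to which only the terms of `A` acting on the spin at the origin
contribute. So it suffices to control the two rotation steps near the origin. The energy change of
a flip confined to a bounded window is an affine function of some coupling `h i` or `J i`, with a
coefficient of modulus at least `1`; since the densities are bounded and the window contains
boundedly many flips, all these energy changes are at least `2ε`, except with probability `O(ε)`.
Outside this exceptional event there are no resonant sites near the origin. There the differences
of the energies `E⁽¹'⁾` agree with those of `E`, since block rotations far away commute with the
energy change of a local flip, and hence there are no resonant graphs either. Thus `O⁽¹⁾` and
`O⁽²⁾` commute with `S^z_0`, and the boundedly many generators near the origin have norm at most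
`γ/ε ≤ ε`.
-/

namespace SpinChain

open scoped Matrix.Norms.L2Operator

section Matrices

variable {n : Type*}

/-- `M` maps basis vectors to multiples, by at most `C`, of basis vectors; `f` sends the index of a
row to the index of its only possibly nonzero entry. -/
def IsMonomial (f : n → n) (C : ℝ) (M : Matrix n n ℝ) : Prop :=
  ∀ i j, |M i j| ≤ C ∧ (M i j ≠ 0 → j = f i)

theorem isMonomial_one [DecidableEq n] : IsMonomial id 1 (1 : Matrix n n ℝ) := by
  intro i j
  by_cases h : i = j <;> simp [Matrix.one_apply, h, eq_comm]

theorem IsMonomial.smul {f : n → n} {C : ℝ} {M : Matrix n n ℝ} (hM : IsMonomial f C M) (r : ℝ) :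
    IsMonomial f (|r| * C) (r • M) := by
  intro i j
  rw [Matrix.smul_apply, smul_eq_mul, abs_mul]
  exact ⟨mul_le_mul_of_nonneg_left (hM i j).1 (abs_nonneg r),
    fun h => (hM i j).2 (right_ne_zero_of_mul h)⟩

theorem IsMonomial.mono {f : n → n} {C D : ℝ} {M : Matrix n n ℝ} (hM : IsMonomial f C M)
    (h : C ≤ D) : IsMonomial f D M :=
  fun i j => ⟨(hM i j).1.trans h, (hM i j).2⟩

variable [Fintype n]

theorem IsMonomial.mul {f g : n → n} {C D : ℝ} {M N : Matrix n n ℝ}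
    (hM : IsMonomial f C M) (hN : IsMonomial g D N) : IsMonomial (g ∘ f) (C * D) (M * N) := by
  intro i j
  have hMN : (M * N) i j = M i (f i) * N (f i) j := by
    rw [Matrix.mul_apply]
    refine Finset.sum_eq_single _ (fun k _ hk => ?_) (by simp)
    by_contra hne
    exact hk ((hM i k).2 (left_ne_zero_of_mul hne))
  rw [hMN, abs_mul]
  exact ⟨mul_le_mul (hM _ _).1 (hN _ _).1 (abs_nonneg _) ((abs_nonneg _).trans (hM i i).1),
    fun hne => (hN _ _).2 (right_ne_zero_of_mul hne)⟩

variable [DecidableEq n]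

theorem IsMonomial.norm_le {e : Equiv.Perm n} {C : ℝ} (hC : 0 ≤ C) {M : Matrix n n ℝ}
    (hM : IsMonomial e C M) : ‖M‖ ≤ C := by
  have hfactor : M = Matrix.diagonal (fun i => M i (e i)) * e.permMatrix ℝ := by
    ext i j
    rw [Matrix.diagonal_mul, Equiv.Perm.permMatrix, PEquiv.toMatrix_toPEquiv_apply]
    by_cases h : j = e i
    · simp [h]
    · simp [h, not_imp_comm.mp (hM i j).2 h]
  calc ‖M‖ ≤ ‖Matrix.diagonal fun i => M i (e i)‖ * ‖e.permMatrix ℝ‖ := by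
        conv_lhs => rw [hfactor]
        exact norm_mul_le _ _
    _ ≤ C * 1 := by
        refine mul_le_mul ?_ (Matrix.permMatrix_l2_opNorm_le e) (norm_nonneg _) hC
        rw [Matrix.l2_opNorm_diagonal]
        exact (pi_norm_le_iff_of_nonneg hC).mpr fun i => (hM _ _).1
    _ = C := mul_one C

theorem abs_entry_le_norm (M : Matrix n n ℝ) (i j : n) : |M i j| ≤ ‖M‖ := by
  have h := M.l2_opNorm_mulVec (EuclideanSpace.single j 1)
  rw [PiLp.norm_single, norm_one, mul_one] at h
  refine le_trans ?_ h
  simpa using PiLp.norm_apply_le ((EuclideanSpace.equiv n ℝ).symm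
    (M *ᵥ (EuclideanSpace.single j (1 : ℝ)).ofLp)) i

theorem norm_conj_eq {U : Matrix n n ℝ} (hU : U ∈ Matrix.orthogonalGroup n ℝ)
    (M : Matrix n n ℝ) : ‖Uᵀ * M * U‖ = ‖M‖ := by
  rw [CStarRing.norm_mul_mem_unitary _ hU,
    CStarRing.norm_mem_unitary_mul _ (Matrix.transpose_mem_unitaryGroup_iff.mpr hU)]

theorem norm_conj_mul_sub_le {U : Matrix n n ℝ} (hU : U ∈ Matrix.orthogonalGroup n ℝ)
    (V S : Matrix n n ℝ) :
    ‖(V * U)ᵀ * S * (V * U) - S‖ ≤ ‖Vᵀ * S * V - S‖ + ‖Uᵀ * S * U - S‖ := by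
  have h : (V * U)ᵀ * S * (V * U) - S = Uᵀ * (Vᵀ * S * V - S) * U + (Uᵀ * S * U - S) := by
    rw [Matrix.transpose_mul]
    noncomm_ring
  rw [h]
  exact (norm_add_le _ _).trans_eq (by rw [norm_conj_eq hU])

theorem conj_eq_of_commute {U S : Matrix n n ℝ} (hU : U ∈ Matrix.orthogonalGroup n ℝ)
    (h : Commute S U) : Uᵀ * S * U = S := by
  rw [Matrix.mul_assoc, h.eq, ← Matrix.mul_assoc, (Matrix.mem_orthogonalGroup_iff' n ℝ).mp hU,
    Matrix.one_mul]

theorem exp_mem_orthogonalGroup {A : Matrix n n ℝ} (hA : Aᵀ = -A) :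
    NormedSpace.exp A ∈ Matrix.orthogonalGroup n ℝ := by
  let +nondep : NormedAlgebra ℚ (Matrix n n ℝ) := .restrictScalars ℚ ℝ _
  exact NormedSpace.exp_mem_unitary_of_mem_skewAdjoint <| skewAdjoint.mem_iff.mpr <| by
    rwa [Matrix.star_eq_conjTranspose, Matrix.conjTranspose_eq_transpose_of_trivial]

theorem hasDerivAt_exp_smul_mul_exp_smul_neg (A S : Matrix n n ℝ) (t : ℝ) :
    HasDerivAt (fun u : ℝ => NormedSpace.exp (u • A) * S * NormedSpace.exp (u • -A))
      (NormedSpace.exp (t • A) * (A * S - S * A) * NormedSpace.exp (t • -A)) t := by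
  have h := ((hasDerivAt_exp_smul_const (𝕂 := ℝ) A t).mul_const S).mul
    (hasDerivAt_exp_smul_const' (𝕂 := ℝ) (-A) t)
  refine h.congr_deriv ?_
  noncomm_ring

theorem norm_exp_conj_sub_le {A : Matrix n n ℝ} (hA : Aᵀ = -A) (S : Matrix n n ℝ) :
    ‖(NormedSpace.exp (-A))ᵀ * S * NormedSpace.exp (-A) - S‖ ≤ ‖A * S - S * A‖ := by
  have htranspose (t : ℝ) : (NormedSpace.exp (t • -A))ᵀ = NormedSpace.exp (t • A) := by
    rw [← Matrix.exp_transpose, Matrix.transpose_smul, Matrix.transpose_neg, hA, neg_neg]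
  have hderiv (t : ℝ) : ‖NormedSpace.exp (t • A) * (A * S - S * A) * NormedSpace.exp (t • -A)‖
      = ‖A * S - S * A‖ := by
    rw [← htranspose, norm_conj_eq (exp_mem_orthogonalGroup ?_)]
    rw [Matrix.transpose_smul, Matrix.transpose_neg, hA, smul_neg]
  have h := norm_image_sub_le_of_norm_deriv_le_segment_01'
    (fun t _ => (hasDerivAt_exp_smul_mul_exp_smul_neg A S t).hasDerivWithinAt)
    (fun t _ => (hderiv t).le)
  have htranspose_one := htranspose 1
  rw [one_smul, one_smul] at htranspose_one
  simpa [htranspose_one] using h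

end Matrices

section Commutators

variable {R : Type*} [NormedRing R]

theorem norm_commutator_le (a : R) {s : R} (hs : ‖s‖ ≤ 1) : ‖a * s - s * a‖ ≤ 2 * ‖a‖ :=
  calc ‖a * s - s * a‖ ≤ ‖a‖ * ‖s‖ + ‖s‖ * ‖a‖ :=
        (norm_sub_le _ _).trans (add_le_add (norm_mul_le _ _) (norm_mul_le _ _))
    _ ≤ 2 * ‖a‖ := by nlinarith [norm_nonneg a]

theorem norm_commutator_sum_le {ι : Type*} {I T : Finset ι} {a : ι → R} {s : R} {C : ℝ}
    (hC : 0 ≤ C) (hs : ‖s‖ ≤ 1) (hcomm : ∀ i ∈ I, i ∉ T → Commute s (a i))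
    (ha : ∀ i ∈ I, i ∈ T → ‖a i‖ ≤ C) :
    ‖(∑ i ∈ I, a i) * s - s * ∑ i ∈ I, a i‖ ≤ T.card * (2 * C) := by
  classical
  have hzero (i : ι) (hi : i ∈ I) (hne : a i * s - s * a i ≠ 0) : i ∈ T := by
    by_contra hiT
    exact hne (sub_eq_zero.mpr (hcomm i hi hiT).eq.symm)
  rw [Finset.sum_mul, Finset.mul_sum, ← Finset.sum_sub_distrib, ← Finset.sum_filter_of_ne hzero]
  calc _ ≤ ∑ i ∈ I with i ∈ T, 2 * C := norm_sum_le_of_le _ fun i hi => by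
        rw [Finset.mem_filter] at hi
        exact (norm_commutator_le _ hs).trans
          (mul_le_mul_of_nonneg_left (ha i hi.1 hi.2) zero_le_two)
    _ = (I.filter (· ∈ T)).card * (2 * C) := by rw [Finset.sum_const, nsmul_eq_mul]
    _ ≤ T.card * (2 * C) := by
        gcongr
        exact fun i hi => (Finset.mem_filter.mp hi).2

end Commutators

section Probability

variable {Ω : Type*} [MeasurableSpace Ω] {μ : Measure Ω} [IsProbabilityMeasure μ]

theorem withDensity_abs_mul_add_lt_le {ρ : ℝ} {f : ℝ → ENNReal}
    (hf : ∀ x, f x ≤ ENNReal.ofReal ρ) {a : ℝ} (ha : 1 ≤ |a|) (y δ : ℝ) :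
    volume.withDensity f {x | |a * x + y| < δ} ≤ ENNReal.ofReal ρ * ENNReal.ofReal (2 * δ) := by
  have hball : {x | |a * x + y| < δ} ⊆ Metric.ball (-y / a) δ := by
    intro x (hx : |a * x + y| < δ)
    have ha0 : a ≠ 0 := abs_pos.mp (one_pos.trans_le ha)
    have hxy : a * x + y = a * (x - -y / a) := by field_simp; ring
    rw [hxy, abs_mul] at hx
    rw [Metric.mem_ball, Real.dist_eq]
    exact (le_mul_of_one_le_left (abs_nonneg _) ha).trans_lt hx
  have hmeas : MeasurableSet {x | |a * x + y| < δ} :=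
    measurableSet_lt (by fun_prop) measurable_const
  calc volume.withDensity f {x | |a * x + y| < δ}
      = ∫⁻ x in {x | |a * x + y| < δ}, f x := withDensity_apply _ hmeas
    _ ≤ ∫⁻ _ in {x | |a * x + y| < δ}, ENNReal.ofReal ρ := lintegral_mono fun x => hf x
    _ = ENNReal.ofReal ρ * volume {x | |a * x + y| < δ} := setLIntegral_const _ _
    _ ≤ ENNReal.ofReal ρ * volume (Metric.ball (-y / a) δ) := by gcongr
    _ = ENNReal.ofReal ρ * ENNReal.ofReal (2 * δ) := by rw [Real.volume_ball]

theorem measure_abs_mul_add_lt_le {X Y : Ω → ℝ} (hX : Measurable X) (hY : Measurable Y)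
    (hXY : IndepFun X Y μ) {ρ : ℝ} {f : ℝ → ENNReal} (hf : ∀ x, f x ≤ ENNReal.ofReal ρ)
    (hXf : μ.map X = volume.withDensity f) {a : ℝ} (ha : 1 ≤ |a|) (δ : ℝ) :
    μ {ω | |a * X ω + Y ω| < δ} ≤ ENNReal.ofReal ρ * ENNReal.ofReal (2 * δ) := by
  have : IsProbabilityMeasure (μ.map X) := Measure.isProbabilityMeasure_map hX.aemeasurable
  have : IsProbabilityMeasure (μ.map Y) := Measure.isProbabilityMeasure_map hY.aemeasurable
  have hmeas : MeasurableSet {q : ℝ × ℝ | |a * q.1 + q.2| < δ} :=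
    measurableSet_lt (by fun_prop) measurable_const
  calc μ {ω | |a * X ω + Y ω| < δ}
      = (μ.map fun ω => (X ω, Y ω)) {q : ℝ × ℝ | |a * q.1 + q.2| < δ} :=
        (Measure.map_apply (hX.prodMk hY) hmeas).symm
    _ = ∫⁻ y, μ.map X {x | |a * x + y| < δ} ∂(μ.map Y) := by
        rw [(indepFun_iff_map_prod_eq_prod_map_map hX.aemeasurable hY.aemeasurable).mp hXY,
          Measure.prod_apply_symm hmeas]
        rfl
    _ ≤ ∫⁻ _, ENNReal.ofReal ρ * ENNReal.ofReal (2 * δ) ∂(μ.map Y) :=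
        lintegral_mono fun y => hXf ▸ withDensity_abs_mul_add_lt_le hf ha y δ
    _ = ENNReal.ofReal ρ * ENNReal.ofReal (2 * δ) := by
        rw [lintegral_const, measure_univ, mul_one]

theorem IsDisorder.measure_abs_sum_lt_le {ρ₀ : ℝ} {V : RandomCouplings Ω}
    (hV : IsDisorder μ ρ₀ V) {S : Finset (Fin 3 × ℤ)} {a : Fin 3 × ℤ → ℝ} {q : Fin 3 × ℤ}
    (hq : q ∈ S) (ha : 1 ≤ |a q|) (δ : ℝ) :
    μ {ω | |∑ p ∈ S, a p * V.family p ω| < δ} ≤ ENNReal.ofReal (2 * |ρ₀| * δ) := by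
  classical
  obtain ⟨f, -, hf, hXf⟩ := hV.density q
  have hmeas : Measurable fun ω => ∑ p ∈ S.erase q, a p * V.family p ω :=
    Finset.measurable_sum _ fun p _ => (hV.measurable p).const_mul _
  have hindep : IndepFun (V.family q) (fun ω => ∑ p ∈ S.erase q, a p * V.family p ω) μ := by
    have h := (hV.indep.indepFun_finset {q} (S.erase q) (by simp) hV.measurable).comp
      (measurable_pi_apply (⟨q, Finset.mem_singleton_self q⟩ : ({q} : Finset (Fin 3 × ℤ))))
      (show Measurable fun y : ↥(S.erase q) → ℝ => ∑ p : ↥(S.erase q), a p * y p by fun_prop)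
    convert h using 1
    · rfl
    funext ω
    exact (Finset.sum_coe_sort (S.erase q) fun p => a p * V.family p ω).symm
  calc μ {ω | |∑ p ∈ S, a p * V.family p ω| < δ}
      = μ {ω | |a q * V.family q ω + ∑ p ∈ S.erase q, a p * V.family p ω| < δ} := by
        simp only [fun ω => Finset.add_sum_erase S (fun p => a p * V.family p ω) hq]
    _ ≤ ENNReal.ofReal ρ₀ * ENNReal.ofReal (2 * δ) :=
        measure_abs_mul_add_lt_le (hV.measurable q) hmeas hindep hf hXf ha δ
    _ ≤ ENNReal.ofReal |ρ₀| * ENNReal.ofReal (2 * δ) := by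
        gcongr
        exact le_abs_self _
    _ = ENNReal.ofReal (2 * |ρ₀| * δ) := by
        rw [← ENNReal.ofReal_mul (abs_nonneg _)]
        ring_nf

theorem abs_integral_sub_one_le {X : Ω → ℝ} (hX : AEMeasurable X μ)
    (hX01 : ∀ᵐ ω ∂μ, X ω ∈ Set.Icc 0 1) {δ : ℝ} (hδ : 0 ≤ δ) {D : Set Ω} (hD : MeasurableSet D)
    (hXD : ∀ᵐ ω ∂μ, ω ∉ D → 1 - δ ≤ X ω) :
    Integrable X μ ∧ |∫ ω, X ω ∂μ - 1| ≤ δ + μ.real D := by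
  have hXint : Integrable X μ := by
    refine Integrable.of_bound hX.aestronglyMeasurable 1 ?_
    filter_upwards [hX01] with ω hω
    rw [Real.norm_of_nonneg hω.1]
    exact hω.2
  have hupper : ∫ ω, X ω ∂μ ≤ 1 := by
    simpa using integral_mono_ae hXint (integrable_const (1 : ℝ)) (hX01.mono fun ω hω => hω.2)
  have hlower : 1 - (δ + μ.real D) ≤ ∫ ω, X ω ∂μ :=
    calc 1 - (δ + μ.real D) = ∫ ω, (1 - δ - D.indicator 1 ω) ∂μ := by
          rw [integral_sub (integrable_const _) ((integrable_const 1).indicator hD),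
            integral_indicator_one hD]
          simp
          ring
      _ ≤ ∫ ω, X ω ∂μ := by
          refine integral_mono_ae
            ((integrable_const _).sub ((integrable_const 1).indicator hD)) hXint ?_
          filter_upwards [hX01, hXD] with ω hω hωD
          by_cases hmem : ω ∈ D
          · simp only [Set.indicator_of_mem hmem, Pi.one_apply]
            linarith [hω.1]
          · simpa [Set.indicator_of_notMem hmem] using hωD hmem
  exact ⟨hXint, abs_sub_le_iff.mpr ⟨by linarith [measureReal_nonneg (μ := μ) (s := D)],
    by linarith⟩⟩

end Probability

section Couplings

variable {c : Couplings}

theorem Couplings.ε_pos (hγ : 0 < c.γ) : 0 < c.ε := Real.rpow_pos_of_pos hγ _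

theorem Couplings.ε_le_one (hγ : 0 < c.γ) (hγ1 : c.γ ≤ 1) : c.ε ≤ 1 :=
  Real.rpow_le_one hγ.le hγ1 (by norm_num)

theorem Couplings.γ_eq_ε_pow (hγ : 0 < c.γ) : c.γ = c.ε ^ 20 := by
  rw [Couplings.ε, ← Real.rpow_natCast, ← Real.rpow_mul hγ.le]
  norm_num

theorem Couplings.γ_div_ε_le_ε (hγ : 0 < c.γ) (hγ1 : c.γ ≤ 1) : c.γ / c.ε ≤ c.ε := by
  have hε := Couplings.ε_pos hγ
  rw [div_le_iff₀ hε, Couplings.γ_eq_ε_pow hγ, ← sq]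
  exact pow_le_pow_of_le_one hε.le (Couplings.ε_le_one hγ hγ1) (by norm_num)

end Couplings

section Configurations

variable {Λ : Box}

theorem spin_apply_coe (σ : Config Λ) (i : Λ.sites) : spin σ i = ((σ i : ℤ) : ℝ) := by
  simp [spin]

theorem spin_of_notMem (σ : Config Λ) {i : ℤ} (hi : i ∉ Λ.sites) : spin σ i = 1 := by
  simp [spin, hi]

theorem spin_eq_spin_iff {σ τ : Config Λ} (i : Λ.sites) : spin σ i = spin τ i ↔ σ i = τ i := by
  rw [spin_apply_coe, spin_apply_coe, Int.cast_inj, Units.val_inj]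

theorem spin_congr {σ τ : Config Λ} {i : ℤ} (h : ∀ hi : i ∈ Λ.sites, σ ⟨i, hi⟩ = τ ⟨i, hi⟩) :
    spin σ i = spin τ i := by
  by_cases hi : i ∈ Λ.sites
  · exact (spin_eq_spin_iff ⟨i, hi⟩).mpr (h hi)
  · rw [spin_of_notMem σ hi, spin_of_notMem τ hi]

theorem spin_injective : Function.Injective (spin : Config Λ → ℤ → ℝ) :=
  fun _ _ h => funext fun i => (spin_eq_spin_iff i).mp (congrFun h i)

theorem spin_eq_one_or (σ : Config Λ) (i : ℤ) : spin σ i = 1 ∨ spin σ i = -1 := by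
  by_cases hi : i ∈ Λ.sites
  · rw [spin_apply_coe σ ⟨i, hi⟩]
    rcases Int.units_eq_one_or (σ ⟨i, hi⟩) with h | h <;> simp [h]
  · exact Or.inl (spin_of_notMem σ hi)

theorem abs_spin (σ : Config Λ) (i : ℤ) : |spin σ i| = 1 := by
  rcases spin_eq_one_or σ i with h | h <;> simp [h]

theorem spin_one (i : ℤ) : spin (1 : Config Λ) i = 1 := by
  simp [spin]

theorem spin_mul (s σ : Config Λ) (i : ℤ) : spin (s * σ) i = spin s i * spin σ i := by
  by_cases hi : i ∈ Λ.sites <;> simp [spin, hi]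

theorem exists_spin_eq_neg_one {s : Config Λ} (hs : s ≠ 1) : ∃ i ∈ Λ.sites, spin s i = -1 := by
  obtain ⟨i, hi⟩ := Function.ne_iff.mp hs
  refine ⟨i, i.2, (spin_eq_one_or s i).resolve_left fun h => hi ?_⟩
  rwa [← spin_eq_spin_iff, spin_one]

theorem flip_eq_mul (σ : Config Λ) (i : ℤ) : flip σ i = flip 1 i * σ := by
  funext j
  by_cases h : (j : ℤ) = i <;> simp [flip, h]

theorem flip_mul (s σ : Config Λ) (i : ℤ) : flip (s * σ) i = s * flip σ i := by
  rw [flip_eq_mul, flip_eq_mul σ, mul_left_comm]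

theorem eq_flip_comm {σ τ : Config Λ} {i : ℤ} : σ = flip τ i ↔ τ = flip σ i := by
  constructor <;> · rintro rfl; exact (flip_flip _ i).symm

theorem flip_one_ne_one {i : ℤ} (hi : i ∈ Λ.sites) : flip (1 : Config Λ) i ≠ 1 :=
  fun h => by simpa [flip] using congrFun h ⟨i, hi⟩

theorem eq_of_spin_flip_one_ne_one {i k : ℤ} (h : spin (flip (1 : Config Λ) i) k ≠ 1) : k = i := by
  contrapose! h
  rw [← spin_one (Λ := Λ) k]
  exact spin_congr fun hk => by simp [flip, h]

theorem foldl_flip (l : List ℤ) (σ : Config Λ) :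
    l.foldl flip σ = (l.map (flip 1)).prod * σ := by
  induction l generalizing σ with
  | nil => simp
  | cons i l ih =>
    rw [List.foldl_cons, ih, flip_eq_mul, List.map_cons, List.prod_cons, mul_left_comm, mul_assoc]

theorem foldl_flip_perm {l l' : List ℤ} (h : l.Perm l') (σ : Config Λ) :
    l.foldl flip σ = l'.foldl flip σ := by
  rw [foldl_flip, foldl_flip, (h.map _).prod_eq]

theorem Word.walk_eq_mul (w : Word) (σ : Config Λ) : w.walk σ = w.walk 1 * σ := by
  rw [Word.walk, Word.walk, foldl_flip, foldl_flip _ 1, mul_one]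

theorem Word.mem_sites {w : Word} {i : ℤ} :
    i ∈ w.sites ↔ i ∈ w.outL ∨ i = w.center ∨ i ∈ w.outR := by
  rw [Word.sites, List.mem_toFinset, List.mem_append, List.mem_cons]

theorem Word.mem_sites_of_spin_walk_ne_one {w : Word} {i : ℤ}
    (hi : spin (w.walk (1 : Config Λ)) i ≠ 1) : i ∈ w.sites := by
  contrapose! hi
  rw [Word.walk, foldl_flip, mul_one]
  refine List.prod_induction (fun s : Config Λ => spin s i = 1)
    (fun s t hs ht => by rw [spin_mul, hs, ht, one_mul]) (spin_one i) fun s hs => ?_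
  obtain ⟨j, hj, rfl⟩ := List.mem_map.mp hs
  by_contra hne
  exact hi (List.mem_toFinset.mpr (eq_of_spin_flip_one_ne_one hne ▸ hj))

end Configurations

section Energies

variable {Λ : Box}

theorem energy_sub_mul (c : Couplings) (s σ : Config Λ) :
    energy c σ - energy c (s * σ) = ∑ i ∈ Λ.sites, c.h i * (spin σ i * (1 - spin s i))
      + ∑ i ∈ Finset.Icc (-(Λ.left : ℤ) - 1) (Λ.right : ℤ),
        c.J i * (spin σ i * spin σ (i + 1) * (1 - spin s i * spin s (i + 1))) := by
  rw [energy, energy, add_sub_add_comm, ← Finset.sum_sub_distrib, ← Finset.sum_sub_distrib]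
  simp only [spin_mul]
  congr 1 <;> exact Finset.sum_congr rfl fun i _ => by ring

theorem energy_sub_mul_congr (c : Couplings) {s σ τ : Config Λ}
    (h : ∀ i j, |i - j| ≤ 1 → spin s j ≠ 1 → spin σ i = spin τ i) :
    energy c σ - energy c (s * σ) = energy c τ - energy c (s * τ) := by
  rw [energy_sub_mul, energy_sub_mul]
  congr 1 <;> refine Finset.sum_congr rfl fun i _ => ?_
  · by_cases hi : spin s i = 1
    · simp only [hi, sub_self, mul_zero]
    · rw [h i i (by simp) hi]
  · by_cases hi : spin s i = 1
    · by_cases hi' : spin s (i + 1) = 1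
      · simp only [hi, hi', mul_one, sub_self, mul_zero]
      · rw [h i (i + 1) (by simp) hi', h (i + 1) (i + 1) (by simp) hi']
    · rw [h i i (by simp) hi, h (i + 1) i (by simp) hi]

/-- The coefficients of the random couplings in the energy change `E(σ) - E(sσ)`. -/
noncomputable def energyCoeff (s σ : Config Λ) (p : Fin 3 × ℤ) : ℝ :=
  ![spin σ p.2 * (1 - spin s p.2), 0,
    spin σ p.2 * spin σ (p.2 + 1) * (1 - spin s p.2 * spin s (p.2 + 1))] p.1

variable {Ω : Type*}

theorem energy_sub_mul_eq_sum (V : RandomCouplings Ω) (γ : ℝ) (ω : Ω) (s σ : Config Λ) :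
    energy (V.at γ ω) σ - energy (V.at γ ω) (s * σ)
      = ∑ p ∈ (Finset.univ : Finset (Fin 3)) ×ˢ Finset.Icc (-(Λ.left : ℤ) - 1) (Λ.right : ℤ),
        energyCoeff s σ p * V.family p ω := by
  have hsites : Λ.sites ⊆ Finset.Icc (-(Λ.left : ℤ) - 1) (Λ.right : ℤ) :=
    Finset.Icc_subset_Icc_left (by omega)
  have hfield : ∀ i ∉ Λ.sites, (V.at γ ω).h i * (spin σ i * (1 - spin s i)) = 0 := by
    intro i hi
    rw [spin_of_notMem s hi, sub_self, mul_zero, mul_zero]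
  rw [energy_sub_mul, Finset.sum_subset hsites fun i _ => hfield i, Finset.sum_product,
    Fin.sum_univ_three]
  simp [energyCoeff, RandomCouplings.family, RandomCouplings.at, mul_comm]

variable [MeasurableSpace Ω] {μ : Measure Ω} {ρ₀ : ℝ} {V : RandomCouplings Ω}

theorem IsDisorder.measurable_energy (hV : IsDisorder μ ρ₀ V) (γ : ℝ) (σ : Config Λ) :
    Measurable fun ω => energy (V.at γ ω) σ := by
  have hh (i : ℤ) : Measurable fun ω => (V.at γ ω).h i := hV.measurable (0, i)
  have hJ (i : ℤ) : Measurable fun ω => (V.at γ ω).J i := hV.measurable (2, i)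
  unfold energy
  fun_prop

theorem IsDisorder.measure_abs_energy_sub_lt_le [IsProbabilityMeasure μ]
    (hV : IsDisorder μ ρ₀ V) (γ : ℝ) {s : Config Λ} (hs : s ≠ 1) (σ : Config Λ) (δ : ℝ) :
    μ {ω | |energy (V.at γ ω) σ - energy (V.at γ ω) (s * σ)| < δ}
      ≤ ENNReal.ofReal (2 * |ρ₀| * δ) := by
  simp only [energy_sub_mul_eq_sum]
  obtain ⟨i, hi, hsi⟩ := exists_spin_eq_neg_one hs
  refine hV.measure_abs_sum_lt_le (q := (0, i)) ?_ ?_ δ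
  · rw [Box.sites, Finset.mem_Icc] at hi
    exact Finset.mk_mem_product (Finset.mem_univ _) (Finset.mem_Icc.mpr ⟨by omega, hi.2⟩)
  · simp only [energyCoeff, Matrix.cons_val_zero, hsi, abs_mul, abs_spin]
    norm_num

end Energies

section Nonresonance

variable {Λ : Box}

/-- The event that no change of the spins at distance at most `N` from the origin is resonant. The
factor `2` leaves room for the factorials `(n!)^(2/9)`, `n ≤ 2`, in the second resonance condition
of step 2. -/
def NonresonantWithin (N : ℕ) (c : Couplings) (Λ : Box) : Prop :=
  ∀ s σ : Config Λ, s ≠ 1 → (∀ i, spin s i ≠ 1 → |i| ≤ N) →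
    2 * c.ε ≤ |energy c σ - energy c (s * σ)|

open Classical in
/-- The configurations with all spins `+1` at distance larger than `N` from the origin. -/
noncomputable def localConfigs (N : ℕ) (Λ : Box) : Finset (Config Λ) :=
  Finset.univ.filter fun σ => ∀ i, spin σ i ≠ 1 → |i| ≤ N

theorem mem_localConfigs {N : ℕ} {σ : Config Λ} :
    σ ∈ localConfigs N Λ ↔ ∀ i, spin σ i ≠ 1 → |i| ≤ N := by
  simp [localConfigs]

theorem card_localConfigs_le (N : ℕ) (Λ : Box) : (localConfigs N Λ).card ≤ 2 ^ (2 * N + 1) := by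
  classical
  have hcard : (Finset.Icc (-N : ℤ) N).card = 2 * N + 1 := by
    rw [Int.card_Icc]
    omega
  rw [← hcard, ← Finset.card_powerset]
  refine Finset.card_le_card_of_injOn (fun σ => (Finset.Icc (-N : ℤ) N).filter (spin σ · ≠ 1))
    (fun σ _ => Finset.mem_powerset.mpr (Finset.filter_subset _ _)) fun σ hσ τ hτ hστ => ?_
  have hiff (i : ℤ) : spin σ i ≠ 1 ↔ spin τ i ≠ 1 := by
    have hi := Finset.ext_iff.mp hστ i
    simp only [Finset.mem_filter, Finset.mem_Icc, ← abs_le] at hi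
    exact ⟨fun h => (hi.mp ⟨mem_localConfigs.mp hσ i h, h⟩).2,
      fun h => (hi.mpr ⟨mem_localConfigs.mp hτ i h, h⟩).2⟩
  refine spin_injective (funext fun i => ?_)
  rcases spin_eq_one_or σ i with h | h <;> rcases spin_eq_one_or τ i with h' | h'
  · rw [h, h']
  · exact absurd h ((hiff i).mpr (by norm_num [h']))
  · exact absurd h' ((hiff i).mp (by norm_num [h]))
  · rw [h, h']

theorem exists_mem_localConfigs_of_not_nonresonantWithin {N : ℕ} {c : Couplings}
    (h : ¬NonresonantWithin N c Λ) :
    ∃ s ∈ (localConfigs N Λ).erase 1, ∃ σ ∈ localConfigs (N + 1) Λ,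
      |energy c σ - energy c (s * σ)| < 2 * c.ε := by
  simp only [NonresonantWithin, not_forall, not_le] at h
  obtain ⟨s, σ, hs, hsN, hlt⟩ := h
  set σN : Config Λ := fun i => if |(i : ℤ)| ≤ N + 1 then σ i else 1
  refine ⟨s, Finset.mem_erase.mpr ⟨hs, mem_localConfigs.mpr hsN⟩, σN,
    mem_localConfigs.mpr fun i hi => ?_, ?_⟩
  · contrapose! hi
    push_cast at hi
    rw [← spin_one (Λ := Λ) i]
    exact spin_congr fun _ => if_neg (not_le.mpr hi)
  · rwa [energy_sub_mul_congr c (τ := σ)]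
    intro i j hij hj
    have hjN := hsN j hj
    exact spin_congr fun _ => if_pos (show |i| ≤ (N : ℤ) + 1 by grind)

theorem measurableSet_nonresonantWithin {Ω : Type*} [MeasurableSpace Ω] {μ : Measure Ω} {ρ₀ : ℝ}
    {V : RandomCouplings Ω} (hV : IsDisorder μ ρ₀ V) (N : ℕ) (γ : ℝ) (Λ : Box) :
    MeasurableSet {ω | NonresonantWithin N (V.at γ ω) Λ} := by
  simp only [NonresonantWithin, Set.ofPred_forall]
  refine .iInter fun s => .iInter fun σ => .iInter fun _ => .iInter fun _ => ?_
  exact measurableSet_le (measurable_const (a := 2 * γ ^ (1 / 20 : ℝ)))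
    ((hV.measurable_energy γ σ).sub (hV.measurable_energy γ (s * σ))).abs

theorem measure_not_nonresonantWithin_le {Ω : Type*} [MeasurableSpace Ω] {μ : Measure Ω}
    [IsProbabilityMeasure μ] {ρ₀ : ℝ} {V : RandomCouplings Ω} (hV : IsDisorder μ ρ₀ V) (N : ℕ)
    (γ : ℝ) (Λ : Box) :
    μ {ω | ¬NonresonantWithin N (V.at γ ω) Λ}
      ≤ ENNReal.ofReal (2 ^ (4 * N + 6) * |ρ₀| * γ ^ (1 / 20 : ℝ)) := by
  set bad : Config Λ → Config Λ → Set Ω := fun s σ =>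
    {ω | |energy (V.at γ ω) σ - energy (V.at γ ω) (s * σ)| < 2 * γ ^ (1 / 20 : ℝ)}
  have hcover : {ω | ¬NonresonantWithin N (V.at γ ω) Λ}
      ⊆ ⋃ q ∈ (localConfigs N Λ).erase 1 ×ˢ localConfigs (N + 1) Λ, bad q.1 q.2 := by
    intro ω hω
    obtain ⟨s, hs, σ, hσ, hlt⟩ := exists_mem_localConfigs_of_not_nonresonantWithin hω
    exact Set.mem_biUnion (x := (s, σ)) (Finset.mk_mem_product hs hσ) hlt
  have hcard : ((localConfigs N Λ).erase 1 ×ˢ localConfigs (N + 1) Λ).card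
      ≤ 2 ^ (4 * N + 4) := by
    rw [Finset.card_product]
    calc _ ≤ 2 ^ (2 * N + 1) * 2 ^ (2 * (N + 1) + 1) :=
          Nat.mul_le_mul ((Finset.card_erase_le).trans (card_localConfigs_le N Λ))
            (card_localConfigs_le (N + 1) Λ)
      _ = 2 ^ (4 * N + 4) := by ring
  calc μ {ω | ¬NonresonantWithin N (V.at γ ω) Λ}
      ≤ ∑ q ∈ (localConfigs N Λ).erase 1 ×ˢ localConfigs (N + 1) Λ, μ (bad q.1 q.2) :=
        (measure_mono hcover).trans (measure_biUnion_finset_le _ _)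
    _ ≤ ((localConfigs N Λ).erase 1 ×ˢ localConfigs (N + 1) Λ).card
          • ENNReal.ofReal (2 * |ρ₀| * (2 * γ ^ (1 / 20 : ℝ))) :=
        Finset.sum_le_card_nsmul _ _ _ fun q hq => hV.measure_abs_energy_sub_lt_le γ
          (Finset.ne_of_mem_erase (Finset.mem_product.mp hq).1) q.2 _
    _ ≤ 2 ^ (4 * N + 4) • ENNReal.ofReal (2 * |ρ₀| * (2 * γ ^ (1 / 20 : ℝ))) := by gcongr
    _ = ENNReal.ofReal (2 ^ (4 * N + 6) * |ρ₀| * γ ^ (1 / 20 : ℝ)) := by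
        rw [← ENNReal.ofReal_nsmul, nsmul_eq_mul]
        push_cast
        ring_nf

end Nonresonance

section Words

theorem interleavings_le_factorial (v : Finset ℤ) (ls rs : List ℤ) :
    interleavings v ls rs ≤ (ls.length + rs.length).factorial := by
  fun_induction interleavings v ls rs with
  | case1 => simp
  | case2 v l ls _ ih => exact ih.trans (Nat.factorial_le (by simp))
  | case3 => exact Nat.zero_le _
  | case4 v r rs _ ih => exact ih.trans (Nat.factorial_le (by simp))
  | case5 => exact Nat.zero_le _
  | case6 v l ls r rs ihl ihr =>
    simp only [List.length_cons, ← add_assoc, add_right_comm _ 1] at ihl ihr ⊢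
    rw [Nat.factorial_succ, add_mul, one_mul]
    have hle : (ls.length + rs.length + 1).factorial
        ≤ (ls.length + rs.length + 1) * (ls.length + rs.length + 1).factorial :=
      Nat.le_mul_of_pos_left _ (Nat.succ_pos _)
    split_ifs <;> omega

theorem interleavings_comm (v : Finset ℤ) (ls rs : List ℤ) :
    interleavings v ls rs = interleavings v rs ls := by
  fun_induction interleavings v ls rs with
  | case1 => rw [interleavings]
  | case2 v l ls h ih => rw [interleavings, if_pos h, ih]
  | case3 v l ls h => rw [interleavings, if_neg h]
  | case4 v r rs h ih => rw [interleavings, if_pos h, ih]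
  | case5 v r rs h => rw [interleavings, if_neg h]
  | case6 v l ls r rs ihl ihr =>
    conv_rhs => rw [interleavings]
    rw [ihl, ihr, add_comm]

theorem abs_sub_le_of_mem_insert {v : Finset ℤ} {l z k : ℤ} (hv : ∀ x ∈ v, |x - z| ≤ k)
    (hl : ∃ x ∈ v, |l - x| ≤ 1) : ∀ x ∈ insert l v, |x - z| ≤ k + 1 := by
  intro x hx
  rcases Finset.mem_insert.mp hx with rfl | hx
  · obtain ⟨y, hy, hxy⟩ := hl
    linarith [abs_sub_le x y z, hv y hy]
  · linarith [hv x hx]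

theorem abs_sub_le_of_interleavings_ne_zero {v : Finset ℤ} {ls rs : List ℤ} {x z k : ℤ}
    (hv : ∀ y ∈ v, |y - z| ≤ k) (h : interleavings v ls rs ≠ 0)
    (hx : x ∈ v ∨ x ∈ ls ∨ x ∈ rs) : |x - z| ≤ k + ls.length + rs.length := by
  fun_induction interleavings v ls rs generalizing k with
  | case1 v => simpa using hv x (by simpa using hx)
  | case2 v l ls hl ih =>
    have := ih (abs_sub_le_of_mem_insert hv hl) h (by grind)
    grind
  | case3 => exact absurd rfl h
  | case4 v r rs hr ih =>
    have := ih (abs_sub_le_of_mem_insert hv hr) h (by grind)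
    grind
  | case5 => exact absurd rfl h
  | case6 v l ls r rs ihl ihr =>
    rw [ne_eq, Nat.add_eq_zero_iff, not_and_or, ← ne_eq, ← ne_eq, ite_ne_right_iff,
      ite_ne_right_iff] at h
    rcases h with ⟨hl, hne⟩ | ⟨hr, hne⟩
    · have := ihl (abs_sub_le_of_mem_insert hv hl) hne (by grind)
      grind
    · have := ihr (abs_sub_le_of_mem_insert hv hr) hne (by grind)
      grind

theorem Word.abs_sub_center_le {w : Word} (hw : w.multiplicity ≠ 0) {x : ℤ} (hx : x ∈ w.sites) :
    |x - w.center| ≤ w.order := by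
  have h := abs_sub_le_of_interleavings_ne_zero (v := {w.center}) (z := w.center) (k := 0)
    (by simp) hw (x := x) (by rw [Word.mem_sites] at hx; simp only [Finset.mem_singleton]; tauto)
  rwa [zero_add, ← Nat.cast_add] at h

theorem Word.abs_sub_le {w : Word} (hw : w.multiplicity ≠ 0) {x y : ℤ} (hx : x ∈ w.sites)
    (hy : y ∈ w.sites) : |x - y| ≤ 2 * w.order := by
  have hxz := Word.abs_sub_center_le hw hx
  have hyz := Word.abs_sub_center_le hw hy
  rw [abs_sub_comm] at hyz
  linarith [_root_.abs_sub_le x w.center y]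

/-- The word of the reversed ordered product, which up to sign is the transposed one. -/
def Word.reverse (w : Word) : Word := ⟨w.outR, w.center, w.outL⟩

theorem Word.order_reverse (w : Word) : w.reverse.order = w.order := Nat.add_comm _ _

theorem Word.length_reverse (w : Word) : w.reverse.length = w.length :=
  congrArg (· + 1) w.order_reverse

theorem Word.sites_reverse (w : Word) : w.reverse.sites = w.sites := by
  ext i
  simp only [Word.mem_sites, Word.reverse]
  tauto

theorem Word.multiplicity_reverse (w : Word) : w.reverse.multiplicity = w.multiplicity :=
  interleavings_comm _ _ _

theorem Word.isGraph_reverse {c : Couplings} {Λ : Box} {w : Word} :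
    IsGraph c Λ w.reverse ↔ IsGraph c Λ w := by
  have h : (∀ i ∈ w.reverse.outL ++ w.reverse.outR, i ∉ S1 c Λ) ↔
      ∀ i ∈ w.outL ++ w.outR, i ∉ S1 c Λ := by
    simp only [Word.reverse, List.mem_append, or_comm]
  rw [IsGraph, h, Word.sites_reverse, Word.multiplicity_reverse, Word.order_reverse]
  rfl

theorem Word.isExternal_reverse {c : Couplings} {Λ : Box} {w : Word} :
    IsExternal c Λ w.reverse ↔ IsExternal c Λ w := by
  rw [IsExternal, Word.isGraph_reverse, Word.sites_reverse, IsExternal]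

theorem finite_setOf_word (n : ℕ) (X : Finset ℤ) :
    {w : Word | w.order ≤ n ∧ w.sites ⊆ X}.Finite := by
  have hlists : {l : List ℤ | l.length ≤ n ∧ ∀ i ∈ l, i ∈ X}.Finite := by
    refine ((List.finite_length_le X n).image (List.map (↑))).subset fun l hl => ?_
    refine ⟨l.attachWith (· ∈ X) hl.2, by simpa using hl.1, by simp⟩
  refine ((hlists.prod (X.finite_toSet.prod hlists)).image
    fun q => (⟨q.1, q.2.1, q.2.2⟩ : Word)).subset fun w hw => ?_
  have hmem (i : ℤ) (hi : i ∈ w.outL ∨ i = w.center ∨ i ∈ w.outR) : i ∈ X :=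
    hw.2 (Word.mem_sites.mpr hi)
  have horder : w.outL.length + w.outR.length ≤ n := hw.1
  refine ⟨(w.outL, w.center, w.outR), ⟨⟨by dsimp only; omega, fun i hi => hmem i (.inl hi)⟩,
    hmem _ (.inr (.inl rfl)), by dsimp only; omega, fun i hi => hmem i (.inr (.inr hi))⟩, rfl⟩

/-- The words with at most `n` generators and with all sites in `X`. -/
noncomputable def shortWords (n : ℕ) (X : Finset ℤ) : Finset Word :=
  (finite_setOf_word n X).toFinset

theorem mem_shortWords {n : ℕ} {X : Finset ℤ} {w : Word} :
    w ∈ shortWords n X ↔ w.order ≤ n ∧ w.sites ⊆ X :=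
  Set.Finite.mem_toFinset _

end Words

section GraphTerms

variable {c : Couplings} {Λ : Box}

theorem transpose_A1 (c : Couplings) (i : ℤ) : (A1 c Λ i)ᵀ = -A1 c Λ i := by
  ext σ τ
  rw [Matrix.transpose_apply, Matrix.neg_apply, A1, A1]
  by_cases hτ : τ = flip σ i
  · rw [if_pos (eq_flip_comm.mp hτ), if_pos hτ, ← neg_sub, div_neg]
  · rw [if_neg (eq_flip_comm.not.mp hτ), if_neg hτ, neg_zero]

theorem transpose_prod_A1 (c : Couplings) (l : List ℤ) :
    ((l.map (A1 c Λ)).prod)ᵀ = ((-1 : ℝ) ^ l.length) • (l.reverse.map (A1 c Λ)).prod := by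
  induction l with
  | nil => simp
  | cons i l ih =>
    rw [List.map_cons, List.prod_cons, Matrix.transpose_mul, ih, transpose_A1, List.reverse_cons,
      List.map_append, List.prod_append, List.length_cons, pow_succ]
    simp

theorem transpose_J0 (c : Couplings) (i : ℤ) : (J0 c Λ i)ᵀ = J0 c Λ i := by
  rw [J0, Matrix.transpose_smul, ← Matrix.conjTranspose_eq_transpose_of_trivial,
    (Sx_isHermitian Λ i).eq]

open Classical in
/-- The coefficient of the graph `w` without its sign: the number of nested commutators which
contain it times `1/n!` or `n/(n+1)!`. -/
noncomputable def graphWeight (c : Couplings) (Λ : Box) (w : Word) : ℝ :=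
  w.multiplicity * if w.center ∈ S1 c Λ then 1 / (w.order.factorial : ℝ)
    else (w.order : ℝ) / ((w.order + 1).factorial : ℝ)

theorem graphWeight_reverse (c : Couplings) (Λ : Box) (w : Word) :
    graphWeight c Λ w.reverse = graphWeight c Λ w := by
  rw [graphWeight, graphWeight, Word.multiplicity_reverse, Word.order_reverse]
  rfl

theorem abs_graphWeight_le_one (c : Couplings) (Λ : Box) (w : Word) : |graphWeight c Λ w| ≤ 1 := by
  have hpos : (0 : ℝ) < w.order.factorial := by positivity
  have hmultiplicity : (w.multiplicity : ℝ) ≤ w.order.factorial := by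
    exact_mod_cast interleavings_le_factorial {w.center} w.outL w.outR
  have hcoeff : (w.order : ℝ) / ((w.order + 1).factorial : ℝ) ≤ 1 / w.order.factorial := by
    rw [Nat.factorial_succ, div_le_div_iff₀ (by positivity) hpos]
    push_cast
    nlinarith
  have hle : graphWeight c Λ w ≤ w.order.factorial * (1 / w.order.factorial) := by
    rw [graphWeight]
    refine mul_le_mul hmultiplicity ?_ (by split_ifs <;> positivity) hpos.le
    split_ifs
    · exact le_rfl
    · exact hcoeff
  rw [abs_of_nonneg (by rw [graphWeight]; split_ifs <;> positivity)]
  exact hle.trans_eq (mul_one_div_cancel hpos.ne')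

theorem graphTerm_eq (c : Couplings) (Λ : Box) (w : Word) :
    graphTerm c Λ w = ((-1) ^ w.outR.length * graphWeight c Λ w) •
      ((w.outL.reverse.map (A1 c Λ)).prod * J0 c Λ w.center * (w.outR.map (A1 c Λ)).prod) := by
  rw [graphTerm, graphWeight, mul_comm (w.multiplicity : ℝ), mul_assoc]

theorem transpose_graphTerm (c : Couplings) (w : Word) :
    (graphTerm c Λ w)ᵀ = graphTerm c Λ w.reverse := by
  have houtL := transpose_prod_A1 (Λ := Λ) c w.outL.reverse
  rw [List.reverse_reverse, List.length_reverse] at houtL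
  have hsign : ((-1 : ℝ) ^ w.outR.length) * (-1) ^ w.outR.length = 1 := by
    rw [← mul_pow, neg_mul_neg, one_mul, one_pow]
  rw [graphTerm_eq, graphTerm_eq, graphWeight_reverse, Matrix.transpose_smul,
    Matrix.transpose_mul, Matrix.transpose_mul, houtL, transpose_J0, transpose_prod_A1]
  simp only [Word.reverse, Matrix.smul_mul, Matrix.mul_smul, smul_smul, Matrix.mul_assoc]
  congr 1
  linear_combination graphWeight c Λ w * (-1) ^ w.outL.length * hsign

theorem mem_S1 {i : ℤ} : i ∈ S1 c Λ ↔ i ∈ Λ.sites ∧ IsResonantSite c Λ i := by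
  simp only [S1, Finset.mem_filter]

theorem isMonomial_A1 (hγ : 0 < c.γ) (hΓ : ∀ i, |c.Γ i| ≤ 1) {i : ℤ} (hi : i ∈ Λ.sites)
    (hS : i ∉ S1 c Λ) : IsMonomial (fun σ => flip σ i) (c.γ / c.ε) (A1 c Λ i) := by
  have hε := Couplings.ε_pos hγ
  intro σ τ
  rw [A1]
  split_ifs with hτ
  · refine ⟨?_, fun _ => hτ⟩
    have hres : c.ε ≤ |energy c σ - energy c τ| := by
      by_contra! h
      exact hS (mem_S1.mpr ⟨hi, σ, hτ ▸ h⟩)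
    rw [abs_div, abs_mul, abs_of_pos hγ]
    exact div_le_div₀ hγ.le (mul_le_of_le_one_right hγ.le (hΓ i)) hε hres
  · simp only [abs_zero, ne_eq, not_true_eq_false, false_implies, and_true]
    positivity

theorem isMonomial_prod_A1 (hγ : 0 < c.γ) (hΓ : ∀ i, |c.Γ i| ≤ 1) {l : List ℤ}
    (hl : ∀ i ∈ l, i ∈ Λ.sites ∧ i ∉ S1 c Λ) :
    IsMonomial (fun σ => l.foldl flip σ) ((c.γ / c.ε) ^ l.length) (l.map (A1 c Λ)).prod := by
  induction l with
  | nil => exact isMonomial_one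
  | cons i l ih =>
    rw [List.forall_mem_cons] at hl
    rw [List.map_cons, List.prod_cons, List.length_cons, pow_succ']
    exact (isMonomial_A1 hγ hΓ hl.1.1 hl.1.2).mul (ih hl.2)

theorem isMonomial_J0 (hγ : 0 < c.γ) (hΓ : ∀ i, |c.Γ i| ≤ 1) (i : ℤ) :
    IsMonomial (fun σ => flip σ i) c.γ (J0 c Λ i) := by
  intro σ τ
  rw [J0, Matrix.smul_apply, Sx, smul_eq_mul]
  split_ifs with hτ
  · rw [mul_one, abs_mul, abs_of_pos hγ]
    exact ⟨mul_le_of_le_one_right hγ.le (hΓ i), fun _ => hτ⟩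
  · simpa using hγ.le

theorem isMonomial_graphTerm (hγ : 0 < c.γ) (hΓ : ∀ i, |c.Γ i| ≤ 1) {w : Word}
    (hw : IsGraph c Λ w) :
    IsMonomial w.walk (c.γ * (c.γ / c.ε) ^ w.order) (graphTerm c Λ w) := by
  have hε := Couplings.ε_pos hγ
  have hmem (i : ℤ) (hi : i ∈ w.outL ++ w.outR) : i ∈ Λ.sites ∧ i ∉ S1 c Λ := by
    refine ⟨hw.1 (Word.mem_sites.mpr ?_), hw.2.1 i hi⟩
    rw [List.mem_append] at hi
    tauto
  have hL := isMonomial_prod_A1 hγ hΓ (l := w.outL.reverse) fun i hi =>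
    hmem i (List.mem_append_left _ (List.mem_reverse.mp hi))
  have hR := isMonomial_prod_A1 hγ hΓ (l := w.outR) fun i hi => hmem i (List.mem_append_right _ hi)
  have hprod := (((hL.mul (isMonomial_J0 hγ hΓ w.center)).mul hR).smul
    ((-1) ^ w.outR.length * graphWeight c Λ w)).mono (D := c.γ * (c.γ / c.ε) ^ w.order) <| by
      rw [abs_mul, abs_neg_one_pow, one_mul]
      refine (mul_le_of_le_one_left (by positivity) (abs_graphWeight_le_one c Λ w)).trans_eq ?_
      rw [List.length_reverse, Word.order, pow_add]
      ring
  rw [graphTerm_eq]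
  convert hprod using 1
  funext σ
  simp only [Function.comp_apply]
  rw [foldl_flip_perm w.outL.reverse_perm, Word.walk, List.foldl_append, List.foldl_cons]

end GraphTerms

section Locality

variable {Λ : Box} {X : Finset ℤ} {M N : Op Λ}

/-- The operator `M` acts on the spins in `X` only: it changes no other spins, but its entries may
depend on them. -/
def ActsOn (X : Finset ℤ) (M : Op Λ) : Prop :=
  ∀ σ τ, M σ τ ≠ 0 → ∀ i : Λ.sites, (i : ℤ) ∉ X → σ i = τ i

theorem ActsOn.mono {Y : Finset ℤ} (hM : ActsOn X M) (h : X ⊆ Y) : ActsOn Y M :=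
  fun σ τ hne i hi => hM σ τ hne i fun hX => hi (h hX)

theorem actsOn_one (X : Finset ℤ) : ActsOn X (1 : Op Λ) := by
  intro σ τ hne i _
  rw [Matrix.one_apply, ne_eq, ite_eq_right_iff, Classical.not_imp] at hne
  rw [hne.1]

theorem ActsOn.mul (hM : ActsOn X M) (hN : ActsOn X N) : ActsOn X (M * N) := by
  intro σ τ hne i hi
  rw [Matrix.mul_apply] at hne
  obtain ⟨ρ, -, hρ⟩ := Finset.exists_ne_zero_of_sum_ne_zero hne
  exact (hM σ ρ (left_ne_zero_of_mul hρ) i hi).trans (hN ρ τ (right_ne_zero_of_mul hρ) i hi)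

theorem ActsOn.transpose (hM : ActsOn X M) : ActsOn X Mᵀ :=
  fun σ τ hne i hi => (hM τ σ hne i hi).symm

theorem ActsOn.commute_diagonal (hM : ActsOn X M) {f : Config Λ → ℝ}
    (hf : ∀ σ τ, (∀ i : Λ.sites, (i : ℤ) ∉ X → σ i = τ i) → f σ = f τ) :
    Commute (Matrix.diagonal f) M := by
  ext σ τ
  rw [Matrix.mul_diagonal, Matrix.diagonal_mul, mul_comm]
  by_cases hne : M σ τ = 0
  · rw [hne, zero_mul, zero_mul]
  · rw [hf σ τ (hM σ τ hne)]

theorem ActsOn.commute_Sz (hM : ActsOn X M) {i : ℤ} (hi : i ∉ X) : Commute (Sz Λ i) M :=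
  hM.commute_diagonal fun _ _ h => spin_congr fun hm => h ⟨i, hm⟩ hi

theorem blockProduct_induction {B : Finset (Finset ℤ)} {U : Finset ℤ → Op Λ} (p : Op Λ → Prop)
    (one : p 1) (mul : ∀ M N, p M → p N → p (M * N)) (h : ∀ b ∈ B, p (U b)) :
    p (blockProduct B U) := by
  refine List.prod_induction p mul one fun M hM => ?_
  obtain ⟨b, hb, rfl⟩ := List.mem_map.mp hM
  exact h b (Finset.mem_toList.mp hb)

theorem blockProduct_actsOn {B : Finset (Finset ℤ)} {U : Finset ℤ → Op Λ}
    {Y : Finset ℤ → Finset ℤ} (h : ∀ b ∈ B, ActsOn (Y b) (U b)) :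
    ActsOn (B.biUnion Y) (blockProduct B U) :=
  blockProduct_induction _ (actsOn_one _) (fun _ _ => ActsOn.mul)
    fun b hb => (h b hb).mono (Finset.subset_biUnion_of_mem Y hb)

theorem blockProduct_mem_orthogonalGroup {B : Finset (Finset ℤ)} {U : Finset ℤ → Op Λ}
    (h : ∀ b ∈ B, (U b)ᵀ * U b = 1) :
    blockProduct B U ∈ Matrix.orthogonalGroup (Config Λ) ℝ :=
  blockProduct_induction _ (one_mem _) (fun _ _ => mul_mem)
    fun b hb => (Matrix.mem_orthogonalGroup_iff' _ ℝ).mpr (h b hb)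

end Locality

section FlipInvariance

variable {Λ : Box} {s : Config Λ} {M N : Op Λ}

/-- The operator `M` commutes with the simultaneous flip of the spins where `s = -1`, that is, with
the permutation `σ ↦ sσ` of the basis. -/
def FlipInvariant (s : Config Λ) (M : Op Λ) : Prop :=
  M.submatrix (Equiv.mulLeft s) (Equiv.mulLeft s) = M

theorem flipInvariant_iff : FlipInvariant s M ↔ ∀ σ τ, M (s * σ) (s * τ) = M σ τ :=
  Matrix.ext_iff.symm

theorem flipInvariant_one (s : Config Λ) : FlipInvariant s (1 : Op Λ) :=
  Matrix.submatrix_one_equiv _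

theorem FlipInvariant.mul (hM : FlipInvariant s M) (hN : FlipInvariant s N) :
    FlipInvariant s (M * N) := by
  rw [FlipInvariant, ← Matrix.submatrix_mul_equiv _ _ _ (Equiv.mulLeft s), hM, hN]

theorem FlipInvariant.smul (hM : FlipInvariant s M) (r : ℝ) : FlipInvariant s (r • M) :=
  congrArg (r • ·) hM

theorem FlipInvariant.sum {ι : Type*} {S : Finset ι} {F : ι → Op Λ}
    (hF : ∀ i ∈ S, FlipInvariant s (F i)) : FlipInvariant s (∑ i ∈ S, F i) := by
  refine flipInvariant_iff.mpr fun σ τ => ?_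
  rw [Matrix.sum_apply, Matrix.sum_apply]
  exact Finset.sum_congr rfl fun i hi => flipInvariant_iff.mp (hF i hi) σ τ

theorem FlipInvariant.tsum {ι : Type*} {F : ι → Op Λ} (hF : ∀ i, FlipInvariant s (F i)) :
    FlipInvariant s (∑' i, F i) := by
  by_cases hsum : Summable F
  · have hentry (σ τ : Config Λ) : HasSum (fun i => F i σ τ) ((∑' i, F i) σ τ) :=
      Pi.hasSum.mp (Pi.hasSum.mp hsum.hasSum σ) τ
    refine flipInvariant_iff.mpr fun σ τ => (hentry _ _).unique ?_
    simpa only [flipInvariant_iff.mp (hF _) σ τ] using hentry σ τ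
  · rw [tsum_eq_zero_of_not_summable hsum]
    rfl

theorem flipInvariant_Sx (s : Config Λ) (i : ℤ) : FlipInvariant s (Sx Λ i) :=
  flipInvariant_iff.mpr fun σ τ => by simp only [Sx, flip_mul, mul_right_inj]

theorem flipInvariant_A1 (c : Couplings) {i : ℤ} (h : ∀ k, spin s k ≠ 1 → 1 < |i - k|) :
    FlipInvariant s (A1 c Λ i) := by
  have henergy (σ : Config Λ) : energy c (s * σ) - energy c (flip (s * σ) i)
      = energy c σ - energy c (flip σ i) := by
    rw [flip_eq_mul, flip_eq_mul σ]
    refine energy_sub_mul_congr c fun k j hkj hj => ?_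
    have hsk : spin s k = 1 := by
      by_contra hne
      rw [eq_of_spin_flip_one_ne_one hj] at hkj
      exact (h k hne).not_ge (abs_sub_comm k i ▸ hkj)
    rw [spin_mul, hsk, one_mul]
  refine flipInvariant_iff.mpr fun σ τ => ?_
  simp only [A1, flip_mul, mul_right_inj]
  split_ifs with hτ
  · rw [hτ, ← flip_mul, henergy]
  · rfl

theorem flipInvariant_prod_A1 (c : Couplings) {l : List ℤ}
    (h : ∀ i ∈ l, ∀ k, spin s k ≠ 1 → 1 < |i - k|) : FlipInvariant s (l.map (A1 c Λ)).prod := by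
  refine List.prod_induction _ (fun _ _ => FlipInvariant.mul) (flipInvariant_one s) fun M hM => ?_
  obtain ⟨i, hi, rfl⟩ := List.mem_map.mp hM
  exact flipInvariant_A1 c (h i hi)

theorem flipInvariant_graphTerm (c : Couplings) {w : Word}
    (h : ∀ i ∈ w.sites, ∀ k, spin s k ≠ 1 → 1 < |i - k|) : FlipInvariant s (graphTerm c Λ w) := by
  have hL := flipInvariant_prod_A1 (s := s) c (l := w.outL.reverse) fun i hi =>
    h i (Word.mem_sites.mpr (.inl (List.mem_reverse.mp hi)))
  have hR := flipInvariant_prod_A1 (s := s) c (l := w.outR) fun i hi =>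
    h i (Word.mem_sites.mpr (.inr (.inr hi)))
  exact ((hL.mul ((flipInvariant_Sx s _).smul _)).mul hR).smul _

theorem mem_collar {k : ℕ} {X : Finset ℤ} {x : ℤ} :
    x ∈ collar Λ k X ↔ x ∈ Λ.sites ∧ ∃ y ∈ X, |x - y| ≤ (k : ℤ) := by
  simp only [collar, Finset.mem_filter]

theorem bar1_subset_barbar1 (b : Finset ℤ) : bar1 Λ b ⊆ barbar1 Λ b := fun x hx =>
  mem_collar.mpr ⟨(mem_collar.mp hx).1, x, hx, by simp⟩

theorem flipInvariant_J1sint (c : Couplings) {b : Finset ℤ}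
    (h : ∀ x ∈ barbar1 Λ b, ∀ k, spin s k ≠ 1 → 1 < |x - k|) : FlipInvariant s (J1sint c Λ b) := by
  refine FlipInvariant.tsum fun w => ?_
  split_ifs with hw
  · exact flipInvariant_graphTerm c fun i hi => h i (bar1_subset_barbar1 b (hw.2.2 hi))
  · rfl

theorem IsBlockRotation.flipInvariant {X Y : Finset ℤ} {U : Op Λ}
    (hU : IsBlockRotation X Y M U) (h : ∀ x ∈ Y, spin s x = 1) : FlipInvariant s U := by
  have hfix (i : Λ.sites) (hi : (i : ℤ) ∈ Y) : s i = 1 := by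
    rw [← Pi.one_apply (M := fun _ : Λ.sites => ℤˣ) i, ← spin_eq_spin_iff, h i hi, spin_one]
  refine flipInvariant_iff.mpr fun σ τ => ?_
  by_cases hX : ∀ i : Λ.sites, (i : ℤ) ∉ X → σ i = τ i
  · refine hU.depends _ _ _ _ (fun i hi => ?_) (fun i hi => congrArg (s i * ·) (hX i hi)) hX
    simp only [Pi.mul_apply, hfix i hi, one_mul, and_self]
  · have hzero : U σ τ = 0 := not_not.mp fun hne => hX (hU.acts σ τ hne)
    have hzero' : U (s * σ) (s * τ) = 0 := not_not.mp fun hne =>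
      hX fun i hi => mul_left_cancel (hU.acts _ _ hne i hi)
    rw [hzero, hzero']

end FlipInvariance

section BlockEnergies

variable {Λ : Box} {m₀ : ℕ} {c : Couplings} {U : Finset ℤ → Op Λ}

theorem IsStep1Rotation.blockProduct_mem_orthogonalGroup (hU : IsStep1Rotation m₀ c Λ U)
    {B : Finset (Finset ℤ)} (hB : B ⊆ small1 m₀ c Λ) :
    blockProduct B U ∈ Matrix.orthogonalGroup (Config Λ) ℝ :=
  SpinChain.blockProduct_mem_orthogonalGroup fun b hb => (hU b (hB hb)).orthogonal

theorem IsStep1Rotation.actsOn_O1 (hU : IsStep1Rotation m₀ c Λ U) :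
    ActsOn ((small1 m₀ c Λ).biUnion (bar1 Λ)) (O1 m₀ c Λ U) :=
  blockProduct_actsOn fun b hb => (hU b hb).acts

theorem IsStep1Rotation.energy1_sub (hU : IsStep1Rotation m₀ c Λ U) {s : Config Λ}
    (hs : ∀ b ∈ small1 m₀ c Λ, ∀ x ∈ barbar1 Λ b, ∀ k, spin s k ≠ 1 → 1 < |x - k|)
    (σ : Config Λ) :
    energy1 m₀ c Λ U σ - energy1 m₀ c Λ U (s * σ) = energy c σ - energy c (s * σ) := by
  set O := O1 m₀ c Λ U
  set W := ∑ b ∈ small1 m₀ c Λ, J1sint c Λ b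
  have hflipO : FlipInvariant s O :=
    blockProduct_induction _ (flipInvariant_one s) (fun _ _ => FlipInvariant.mul) fun b hb =>
      (hU b hb).flipInvariant fun x hx => not_not.mp fun hne => by
        simpa using hs b hb x hx x hne
  have hflipW : FlipInvariant s W := .sum fun b hb => flipInvariant_J1sint c (hs b hb)
  have henergy1 : energy1 m₀ c Λ U (s * σ)
      = (Oᵀ * (Matrix.diagonal (fun τ => energy c (s * τ)) + W) * O : Op Λ) σ σ :=
    calc energy1 m₀ c Λ U (s * σ)
        = (Oᵀ * (Matrix.diagonal (energy c) + W) * O : Op Λ).submatrix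
            (Equiv.mulLeft s) (Equiv.mulLeft s) σ σ := rfl
      _ = _ := by
        rw [← Matrix.submatrix_mul_equiv _ _ _ (Equiv.mulLeft s),
          ← Matrix.submatrix_mul_equiv _ _ _ (Equiv.mulLeft s), ← Matrix.transpose_submatrix,
          Matrix.submatrix_add, Pi.add_apply, Pi.add_apply, Matrix.submatrix_diagonal_equiv,
          hflipO, hflipW]
        rfl
  have hcommute : Commute (Matrix.diagonal fun τ => energy c τ - energy c (s * τ)) O := by
    refine hU.actsOn_O1.commute_diagonal fun τ τ' hττ' => energy_sub_mul_congr c fun i j hij hj =>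
      spin_congr fun hi => hττ' ⟨i, hi⟩ fun hib => ?_
    obtain ⟨b, hb, hib⟩ := Finset.mem_biUnion.mp hib
    exact (hs b hb i (bar1_subset_barbar1 b hib) j hj).not_ge hij
  have hO_mem : O ∈ Matrix.orthogonalGroup (Config Λ) ℝ :=
    hU.blockProduct_mem_orthogonalGroup subset_rfl
  calc energy1 m₀ c Λ U σ - energy1 m₀ c Λ U (s * σ)
      = (Oᵀ * Matrix.diagonal (fun τ => energy c τ - energy c (s * τ)) * O : Op Λ) σ σ := by
        rw [henergy1, energy1, ← Matrix.sub_apply, ← sub_mul, ← mul_sub, add_sub_add_right_eq_sub,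
          Matrix.diagonal_sub]
    _ = energy c σ - energy c (s * σ) := by
        rw [conj_eq_of_commute hO_mem hcommute, Matrix.diagonal_apply_eq]

end BlockEnergies

section NearOrigin

variable {Λ : Box} {m₀ N : ℕ} {c : Couplings} {U : Finset ℤ → Op Λ} {w : Word}

theorem subset_of_mem_components {d : ℝ} {T X : Finset ℤ} (h : X ∈ components d T) : X ⊆ T := by
  classical
  simp only [components, Finset.mem_image] at h
  obtain ⟨x, -, rfl⟩ := h
  exact Finset.filter_subset _ _

theorem subset_S1_of_mem_small1 {b : Finset ℤ} (hb : b ∈ small1 m₀ c Λ) : b ⊆ S1 c Λ := by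
  simp only [small1, Finset.mem_filter] at hb
  exact subset_of_mem_components hb.1

theorem remaining_subset (m : ℕ) : remaining m₀ c Λ U m ⊆ S1 c Λ ∪ resonant2 m₀ c Λ U := by
  induction m with
  | zero => exact subset_rfl
  | succ m ih => exact Finset.sdiff_subset.trans ih

theorem subset_of_mem_small2 {b : Finset ℤ} (hb : b ∈ small2 m₀ c Λ U) :
    b ⊆ S1 c Λ ∪ resonant2 m₀ c Λ U := by
  simp only [small2, extract, Finset.mem_filter, Finset.mem_biUnion] at hb
  obtain ⟨⟨m, -, hm, -⟩, -⟩ := hb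
  exact (subset_of_mem_components hm).trans (remaining_subset m)

namespace NonresonantWithin

theorem lt_abs_of_mem_S1 (h : NonresonantWithin N c Λ) (hγ : 0 < c.γ) {i : ℤ} (hi : i ∈ S1 c Λ) :
    (N : ℤ) < |i| := by
  obtain ⟨hiΛ, σ, hσ⟩ := mem_S1.mp hi
  by_contra! hiN
  have hgap := h (flip 1 i) σ (flip_one_ne_one hiΛ) fun k hk =>
    eq_of_spin_flip_one_ne_one hk ▸ hiN
  rw [flip_eq_mul] at hσ
  linarith [Couplings.ε_pos hγ]

theorem lt_abs_of_mem_barbar1 (h : NonresonantWithin N c Λ) (hγ : 0 < c.γ) {b : Finset ℤ}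
    (hb : b ∈ small1 m₀ c Λ) {x : ℤ} (hx : x ∈ barbar1 Λ b) : (N : ℤ) - 2 < |x| := by
  obtain ⟨-, y, hy, hxy⟩ := mem_collar.mp hx
  obtain ⟨-, z, hz, hyz⟩ := mem_collar.mp hy
  have hzN := h.lt_abs_of_mem_S1 hγ (subset_S1_of_mem_small1 hb hz)
  push_cast at hxy hyz
  grind

theorem touched_eq_empty (h : NonresonantWithin N c Λ) (hγ : 0 < c.γ)
    (hw : ∀ x ∈ w.sites, |x| ≤ (N : ℤ) - 2) : touched m₀ c Λ w = ∅ := by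
  refine Finset.filter_false_of_mem fun b hb => not_not.mpr ?_
  exact Finset.disjoint_left.mpr fun x hx hxb =>
    (h.lt_abs_of_mem_barbar1 hγ hb hxb).not_ge (hw x hx)

theorem abs_le_of_mem_support (h : NonresonantWithin N c Λ) (hγ : 0 < c.γ)
    (hw : w.multiplicity ≠ 0) {y : ℤ} (hy : y ∈ support m₀ c Λ w) (hyN : |y| ≤ (N : ℤ) - 2)
    {x : ℤ} (hx : x ∈ w.sites) : |x| ≤ |y| + 2 * w.order := by
  rcases Finset.mem_union.mp hy with hy | hy
  · linarith [Word.abs_sub_le hw hx hy, abs_sub_abs_le_abs_sub x y]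
  · obtain ⟨b, hb, hyb⟩ := Finset.mem_biUnion.mp hy
    have hyN' := h.lt_abs_of_mem_barbar1 hγ (Finset.mem_filter.mp hb).1 (bar1_subset_barbar1 b hyb)
    exact absurd hyN hyN'.not_ge

theorem le_abs_energy1_sub (h : NonresonantWithin N c Λ) (hγ : 0 < c.γ)
    (hU : IsStep1Rotation m₀ c Λ U) (hw : ∀ x ∈ w.sites, |x| ≤ (N : ℤ) - 3) {σ : Config Λ}
    (hσ : σ ≠ w.walk σ) :
    2 * c.ε ≤ |energy1 m₀ c Λ U σ - energy1 m₀ c Λ U (w.walk σ)| := by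
  rw [Word.walk_eq_mul] at hσ ⊢
  have hwN (k : ℤ) (hk : spin (w.walk (1 : Config Λ)) k ≠ 1) : |k| ≤ (N : ℤ) - 3 :=
    hw k (Word.mem_sites_of_spin_walk_ne_one hk)
  rw [hU.energy1_sub fun b hb x hx k hk => ?_]
  · exact h _ σ (right_eq_mul.not.mp hσ) fun k hk => by linarith [hwN k hk]
  · linarith [h.lt_abs_of_mem_barbar1 hγ hb hx, hwN k hk, abs_sub_abs_le_abs_sub x k]

theorem abs_graphTerm_div_le (h : NonresonantWithin N c Λ) (hγ : 0 < c.γ)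
    (hΓ : ∀ i, |c.Γ i| ≤ 1) (hU : IsStep1Rotation m₀ c Λ U) (hgraph : IsGraph c Λ w)
    (hw : ∀ x ∈ w.sites, |x| ≤ (N : ℤ) - 3) {σ : Config Λ} (hσ : σ ≠ w.walk σ) :
    |graphTerm c Λ w σ (w.walk σ) / (energy1 m₀ c Λ U σ - energy1 m₀ c Λ U (w.walk σ))|
      ≤ (c.γ / c.ε) ^ w.length / 2 := by
  have hε := Couplings.ε_pos hγ
  rw [abs_div]
  calc _ ≤ (c.γ * (c.γ / c.ε) ^ w.order) / (2 * c.ε) :=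
        div_le_div₀ (by positivity) (isMonomial_graphTerm hγ hΓ hgraph _ _).1 (by positivity)
          (h.le_abs_energy1_sub hγ hU hw hσ)
    _ = (c.γ / c.ε) ^ w.length / 2 := by
        rw [Word.length, pow_succ]
        field_simp

end NonresonantWithin

theorem touchedRotation_of_touched_eq_empty (h : touched m₀ c Λ w = ∅) :
    touchedRotation m₀ c Λ U w = 1 := by
  rw [touchedRotation, h, blockProduct, Finset.toList_empty, List.map_nil, List.prod_nil]

theorem rotatedTerm_of_touched_eq_empty (h : touched m₀ c Λ w = ∅) :
    rotatedTerm m₀ c Λ U w = graphTerm c Λ w := by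
  rw [rotatedTerm, touchedRotation_of_touched_eq_empty h, Matrix.transpose_one, one_mul, mul_one]

theorem factorial_rpow_le_two {n : ℕ} (hn : n ≤ 2) : (n.factorial : ℝ) ^ (2 / 9 : ℝ) ≤ 2 := by
  have hone : (1 : ℝ) ≤ n.factorial := by exact_mod_cast n.factorial_pos
  calc (n.factorial : ℝ) ^ (2 / 9 : ℝ) ≤ (n.factorial : ℝ) ^ (1 : ℝ) :=
        Real.rpow_le_rpow_of_exponent_le hone (by norm_num)
    _ ≤ 2 := by rw [Real.rpow_one]; exact_mod_cast Nat.factorial_le hn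

namespace NonresonantWithin

theorem not_isResonantGraph (h : NonresonantWithin N c Λ) (hγ : 0 < c.γ) (hγ1 : c.γ ≤ 1)
    (hΓ : ∀ i, |c.Γ i| ≤ 1) (hU : IsStep1Rotation m₀ c Λ U)
    (hw : ∀ x ∈ w.sites, |x| ≤ (N : ℤ) - 3) (α σ β : Config Λ) :
    ¬IsResonantGraph m₀ c Λ U w α σ β := by
  rintro ⟨hext, hlen2, hlen3, -, hagree, hne, hres⟩
  have hε := Couplings.ε_pos hγ
  have htouched : touched m₀ c Λ w = ∅ := h.touched_eq_empty hγ fun x hx => by linarith [hw x hx]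
  rw [touchedSites, htouched, Finset.biUnion_empty] at hagree
  obtain rfl : α = σ := funext fun i => (hagree i (Finset.notMem_empty _)).1
  obtain rfl : β = w.walk α := funext fun i => (hagree i (Finset.notMem_empty _)).2
  rcases hres with hgap | ⟨hratio, -⟩
  · have hpow : c.ε ^ w.length ≤ c.ε :=
      pow_le_of_le_one hε.le (Couplings.ε_le_one hγ hγ1) (by omega)
    linarith [h.le_abs_energy1_sub hγ hU hw hne]
  · rw [touchedRotation_of_touched_eq_empty htouched, Matrix.one_apply_eq, Matrix.one_apply_eq,
      one_mul, mul_one] at hratio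
    refine hratio.not_ge ((h.abs_graphTerm_div_le hγ hΓ hU hext.1 hw hne).trans ?_)
    exact div_le_div_of_nonneg_left (by positivity) (by positivity)
      (factorial_rpow_le_two (by omega))

theorem lt_abs_of_mem_resonant2 (h : NonresonantWithin N c Λ) (hγ : 0 < c.γ) (hγ1 : c.γ ≤ 1)
    (hΓ : ∀ i, |c.Γ i| ≤ 1) (hU : IsStep1Rotation m₀ c Λ U) {y : ℤ}
    (hy : y ∈ resonant2 m₀ c Λ U) : (N : ℤ) - 7 < |y| := by
  simp only [resonant2, Finset.mem_filter] at hy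
  obtain ⟨-, w, ⟨α, σ, β, hres⟩, hyw⟩ := hy
  by_contra! hyN
  have horder : w.order ≤ 2 := Nat.le_of_succ_le_succ hres.2.2.1
  refine h.not_isResonantGraph hγ hγ1 hΓ hU (fun x hx => ?_) α σ β hres
  have hxy := h.abs_le_of_mem_support hγ hres.1.1.2.2.1 hyw (by omega) hx
  omega

theorem lt_dist1_zero (h : NonresonantWithin N c Λ) (hγ : 0 < c.γ) {r : ℕ} (hr : r + 2 ≤ N)
    {y : ℤ} (hy : (r : ℤ) < |y|) : r < dist1 m₀ c Λ 0 y := by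
  have hcontract (k : ℤ) (hk : |k| ≤ r) (b) (hb : b ∈ small1 m₀ c Λ) :
      k ∉ barbar1 Λ b := fun hkb => by
    have := h.lt_abs_of_mem_barbar1 hγ hb hkb
    omega
  rcases lt_abs.mp hy with hy | hy
  · calc r < (Finset.Ico (0 : ℤ) (r + 1)).card := by simp
      _ ≤ dist1 m₀ c Λ 0 y := Finset.card_le_card fun k hk => by
        rw [Finset.mem_Ico] at hk
        refine Finset.mem_filter.mpr ⟨Finset.mem_Ico.mpr (by omega), fun b hb hkb => ?_⟩
        exact hcontract k (by rw [abs_le]; omega) b hb hkb.1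
  · calc r < (Finset.Ico (-(r + 1) : ℤ) 0).card := by simp
      _ ≤ dist1 m₀ c Λ 0 y := Finset.card_le_card fun k hk => by
        rw [Finset.mem_Ico] at hk
        refine Finset.mem_filter.mpr ⟨Finset.mem_Ico.mpr (by omega), fun b hb hkb => ?_⟩
        exact hcontract (k + 1) (by rw [abs_le]; omega) b hb hkb.2

theorem zero_notMem_bar1 (h : NonresonantWithin N c Λ) (hγ : 0 < c.γ) (hN : 2 ≤ N)
    {b : Finset ℤ} (hb : b ∈ small1 m₀ c Λ) : (0 : ℤ) ∉ bar1 Λ b := fun h0 => by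
  have := h.lt_abs_of_mem_barbar1 hγ hb (bar1_subset_barbar1 b h0)
  rw [abs_zero] at this
  omega

theorem zero_notMem_bar2 (h : NonresonantWithin N c Λ) (hγ : 0 < c.γ) (hγ1 : c.γ ≤ 1)
    (hΓ : ∀ i, |c.Γ i| ≤ 1) (hU : IsStep1Rotation m₀ c Λ U) (hN : 10 ≤ N) {b : Finset ℤ}
    (hb : b ∈ small2 m₀ c Λ U) : (0 : ℤ) ∉ bar2 m₀ c Λ b := fun h0 => by
  obtain ⟨-, y, hy, hdist⟩ := Finset.mem_filter.mp h0
  refine (h.lt_dist1_zero hγ (r := 3) (by omega) ?_).not_ge hdist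
  rcases Finset.mem_union.mp (subset_of_mem_small2 hb hy) with hy | hy
  · have := h.lt_abs_of_mem_S1 hγ hy
    push_cast
    omega
  · have := h.lt_abs_of_mem_resonant2 hγ hγ1 hΓ hU hy
    push_cast
    omega

end NonresonantWithin

end NearOrigin

section Generators

variable {Λ : Box} {m₀ N : ℕ} {c : Couplings} {U : Finset ℤ → Op Λ} {w : Word}

theorem Word.touched_reverse (w : Word) : touched m₀ c Λ w.reverse = touched m₀ c Λ w := by
  simp only [touched, Word.sites_reverse]

theorem Word.isPerturbative_reverse :
    IsPerturbative m₀ c Λ U w.reverse ↔ IsPerturbative m₀ c Λ U w := by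
  simp only [IsPerturbative, Word.isExternal_reverse, Word.length_reverse, support, touchedSites,
    Word.touched_reverse, Word.sites_reverse]

theorem transpose_rotatedTerm (w : Word) :
    (rotatedTerm m₀ c Λ U w)ᵀ = rotatedTerm m₀ c Λ U w.reverse := by
  simp only [rotatedTerm, touchedRotation, Word.touched_reverse, Matrix.transpose_mul,
    Matrix.transpose_transpose, transpose_graphTerm, Matrix.mul_assoc]

theorem transpose_A2term (w : Word) :
    (A2term m₀ c Λ U w)ᵀ = -A2term m₀ c Λ U w.reverse := by
  ext α β
  rw [Matrix.transpose_apply, Matrix.neg_apply, A2term, A2term]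
  by_cases h : α = β
  · rw [if_pos h, if_pos h.symm, neg_zero]
  · rw [if_neg h, if_neg (Ne.symm h), ← transpose_rotatedTerm, Matrix.transpose_apply,
      ← neg_sub, div_neg]

theorem transpose_sum_A1 (X : Finset ℤ) : (∑ i ∈ X, A1 c Λ i)ᵀ = -∑ i ∈ X, A1 c Λ i := by
  rw [Matrix.transpose_sum, ← Finset.sum_neg_distrib]
  exact Finset.sum_congr rfl fun i _ => transpose_A1 c i

theorem transpose_A2 : (A2 m₀ c Λ U)ᵀ = -A2 m₀ c Λ U := by
  have hreverse : Function.Involutive Word.reverse := fun _ => rfl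
  rw [A2, Matrix.transpose_tsum, ← tsum_neg, ← (hreverse.toPerm Word.reverse).tsum_eq]
  refine tsum_congr fun w => ?_
  rw [Function.Involutive.coe_toPerm]
  by_cases hw : IsPerturbative m₀ c Λ U w
  · rw [if_pos (Word.isPerturbative_reverse.mpr hw), if_pos hw, transpose_A2term, hreverse]
  · rw [if_neg (Word.isPerturbative_reverse.not.mpr hw), if_neg hw, Matrix.transpose_zero,
      neg_zero]

theorem norm_Sz_le_one (i : ℤ) : ‖Sz Λ i‖ ≤ 1 := by
  rw [Sz, Matrix.l2_opNorm_diagonal]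
  exact (pi_norm_le_iff_of_nonneg zero_le_one).mpr fun σ => (abs_spin σ i).le

theorem actsOn_A1 (i : ℤ) : ActsOn {i} (A1 c Λ i) := by
  intro σ τ hne j hj
  rw [A1, ne_eq, ite_eq_right_iff, Classical.not_imp] at hne
  rw [hne.1, flip, if_neg (Finset.notMem_singleton.mp hj)]

theorem norm_commutator_sum_A1_le (hγ : 0 < c.γ) (hΓ : ∀ i, |c.Γ i| ≤ 1) :
    ‖(∑ i ∈ Λ.sites \ S1 c Λ, A1 c Λ i) * Sz Λ 0 - Sz Λ 0 * ∑ i ∈ Λ.sites \ S1 c Λ, A1 c Λ i‖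
      ≤ 2 * (c.γ / c.ε) := by
  have hε := Couplings.ε_pos hγ
  refine (norm_commutator_sum_le (T := {0}) (C := c.γ / c.ε) (by positivity) (norm_Sz_le_one 0)
    (fun i _ hi => (actsOn_A1 i).commute_Sz ?_) fun i hi _ => ?_).trans_eq (by simp)
  · rwa [Finset.mem_singleton, eq_comm, ← Finset.mem_singleton]
  · rw [Finset.mem_sdiff] at hi
    have hflip : (fun σ => flip σ i) = Equiv.mulLeft (flip (1 : Config Λ) i) :=
      funext fun σ => flip_eq_mul σ i
    exact IsMonomial.norm_le (by positivity) (hflip ▸ isMonomial_A1 hγ hΓ hi.1 hi.2)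

theorem actsOn_graphTerm (hγ : 0 < c.γ) (hΓ : ∀ i, |c.Γ i| ≤ 1) (hw : IsGraph c Λ w) :
    ActsOn w.sites (graphTerm c Λ w) := by
  intro σ τ hne i hi
  rw [(isMonomial_graphTerm hγ hΓ hw σ τ).2 hne, Word.walk_eq_mul, Pi.mul_apply]
  have hwalk : w.walk (1 : Config Λ) i = 1 := by
    rw [← Pi.one_apply (M := fun _ : Λ.sites => ℤˣ) i, ← spin_eq_spin_iff, spin_one]
    exact not_not.mp fun hne => hi (w.mem_sites_of_spin_walk_ne_one hne)
  rw [hwalk, one_mul]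

theorem actsOn_A2term (hγ : 0 < c.γ) (hΓ : ∀ i, |c.Γ i| ≤ 1) (hU : IsStep1Rotation m₀ c Λ U)
    (hw : IsGraph c Λ w) : ActsOn (support m₀ c Λ w) (A2term m₀ c Λ U w) := by
  have hO : ActsOn (support m₀ c Λ w) (touchedRotation m₀ c Λ U w) :=
    (blockProduct_actsOn fun b hb => (hU b (Finset.mem_filter.mp hb).1).acts).mono
      Finset.subset_union_right
  have hrotated : ActsOn (support m₀ c Λ w) (rotatedTerm m₀ c Λ U w) :=
    (hO.transpose.mul ((actsOn_graphTerm hγ hΓ hw).mono Finset.subset_union_left)).mul hO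
  refine fun α β hne => hrotated α β fun h => hne ?_
  rw [A2term, h, zero_div, ite_self]

theorem NonresonantWithin.norm_A2term_le (h : NonresonantWithin N c Λ) (hγ : 0 < c.γ)
    (hγ1 : c.γ ≤ 1) (hΓ : ∀ i, |c.Γ i| ≤ 1) (hU : IsStep1Rotation m₀ c Λ U)
    (hgraph : IsGraph c Λ w) (hw : ∀ x ∈ w.sites, |x| ≤ (N : ℤ) - 3) :
    ‖A2term m₀ c Λ U w‖ ≤ c.γ / c.ε := by
  have hε := Couplings.ε_pos hγ
  have hratio : c.γ / c.ε ≤ 1 := (Couplings.γ_div_ε_le_ε hγ hγ1).trans (Couplings.ε_le_one hγ hγ1)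
  have hwalk : w.walk = Equiv.mulLeft (w.walk (1 : Config Λ)) := funext w.walk_eq_mul
  have htouched : touched m₀ c Λ w = ∅ := h.touched_eq_empty hγ fun x hx => by linarith [hw x hx]
  refine IsMonomial.norm_le (e := Equiv.mulLeft (w.walk 1)) (by positivity) fun α β => ?_
  rw [← hwalk, A2term, rotatedTerm_of_touched_eq_empty htouched]
  by_cases hzero : α = β ∨ graphTerm c Λ w α β = 0
  · have hentry : (if α = β then 0 else graphTerm c Λ w α β /
        (energy1 m₀ c Λ U α - energy1 m₀ c Λ U β)) = 0 := by
      rcases hzero with h | h <;> simp [h]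
    rw [hentry, abs_zero]
    exact ⟨by positivity, fun hne => absurd rfl hne⟩
  · push Not at hzero
    obtain rfl := (isMonomial_graphTerm hγ hΓ hgraph α β).2 hzero.2
    rw [if_neg hzero.1]
    refine ⟨(h.abs_graphTerm_div_le hγ hΓ hU hgraph hw hzero.1).trans ?_, fun _ => rfl⟩
    calc (c.γ / c.ε) ^ w.length / 2 ≤ (c.γ / c.ε) ^ w.length := half_le_self (by positivity)
      _ ≤ c.γ / c.ε := pow_le_of_le_one (by positivity) hratio (Nat.succ_ne_zero _)

theorem IsPerturbative.order_le_two (hw : IsPerturbative m₀ c Λ U w) : w.order ≤ 2 :=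
  Nat.le_of_succ_le_succ hw.2.2.1

open Classical in
theorem A2_eq_sum : A2 m₀ c Λ U =
    ∑ w ∈ shortWords 2 Λ.sites with IsPerturbative m₀ c Λ U w, A2term m₀ c Λ U w := by
  rw [Finset.sum_filter]
  exact tsum_eq_sum fun w hw => if_neg fun hp =>
    hw (mem_shortWords.mpr ⟨hp.order_le_two, hp.1.1.1⟩)

theorem NonresonantWithin.norm_commutator_A2_le (h : NonresonantWithin N c Λ) (hN : 7 ≤ N)
    (hγ : 0 < c.γ) (hγ1 : c.γ ≤ 1) (hΓ : ∀ i, |c.Γ i| ≤ 1) (hU : IsStep1Rotation m₀ c Λ U) :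
    ‖A2 m₀ c Λ U * Sz Λ 0 - Sz Λ 0 * A2 m₀ c Λ U‖
      ≤ (shortWords 2 (Finset.Icc (-4) 4)).card * (2 * (c.γ / c.ε)) := by
  classical
  have hε := Couplings.ε_pos hγ
  rw [A2_eq_sum]
  refine norm_commutator_sum_le (by positivity) (norm_Sz_le_one 0) (fun w hw hfar => ?_)
    fun w hw hnear => ?_
  · have hp := (Finset.mem_filter.mp hw).2
    refine (actsOn_A2term hγ hΓ hU hp.1.1).commute_Sz fun h0 => hfar ?_
    refine mem_shortWords.mpr ⟨hp.order_le_two, fun x hx => Finset.mem_Icc.mpr (abs_le.mp ?_)⟩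
    have hx := h.abs_le_of_mem_support hγ hp.1.1.2.2.1 h0 (by rw [abs_zero]; omega) hx
    have := hp.order_le_two
    rw [abs_zero] at hx
    omega
  · have hp := (Finset.mem_filter.mp hw).2
    refine h.norm_A2term_le hγ hγ1 hΓ hU hp.1.1 fun x hx => ?_
    have hx := abs_le.mpr (Finset.mem_Icc.mp ((mem_shortWords.mp hnear).2 hx))
    omega

end Generators

section CumulativeRotation

variable {Λ : Box} {m₀ N : ℕ} {c : Couplings} {U U' : Finset ℤ → Op Λ}

theorem Omega1_mem_orthogonalGroup :
    Omega1 c Λ ∈ Matrix.orthogonalGroup (Config Λ) ℝ :=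
  exp_mem_orthogonalGroup (by rw [Matrix.transpose_neg, transpose_sum_A1])

theorem Omega2_mem_orthogonalGroup :
    Omega2 m₀ c Λ U ∈ Matrix.orthogonalGroup (Config Λ) ℝ :=
  exp_mem_orthogonalGroup (by rw [Matrix.transpose_neg, transpose_A2])

theorem IsStep1Rotation.O1_mem_orthogonalGroup (hU : IsStep1Rotation m₀ c Λ U) :
    O1 m₀ c Λ U ∈ Matrix.orthogonalGroup (Config Λ) ℝ :=
  hU.blockProduct_mem_orthogonalGroup subset_rfl

theorem IsStep2Rotation.O2_mem_orthogonalGroup (hU' : IsStep2Rotation m₀ c Λ U U') :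
    O2 m₀ c Λ U U' ∈ Matrix.orthogonalGroup (Config Λ) ℝ :=
  blockProduct_mem_orthogonalGroup fun b hb => (hU' b hb).orthogonal

theorem IsStep2Rotation.actsOn_O2 (hU' : IsStep2Rotation m₀ c Λ U U') :
    ActsOn ((small2 m₀ c Λ U).biUnion (bar2 m₀ c Λ)) (O2 m₀ c Λ U U') :=
  blockProduct_actsOn fun b hb => (hU' b hb).acts

theorem R2_mem_orthogonalGroup (hU : IsStep1Rotation m₀ c Λ U)
    (hU' : IsStep2Rotation m₀ c Λ U U') :
    R2 m₀ c Λ U U' ∈ Matrix.orthogonalGroup (Config Λ) ℝ :=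
  mul_mem (mul_mem (mul_mem Omega1_mem_orthogonalGroup hU.O1_mem_orthogonalGroup)
    Omega2_mem_orthogonalGroup) hU'.O2_mem_orthogonalGroup

theorem NonresonantWithin.conj_O1_Sz (h : NonresonantWithin N c Λ) (hN : 2 ≤ N) (hγ : 0 < c.γ)
    (hU : IsStep1Rotation m₀ c Λ U) : (O1 m₀ c Λ U)ᵀ * Sz Λ 0 * O1 m₀ c Λ U = Sz Λ 0 := by
  refine conj_eq_of_commute hU.O1_mem_orthogonalGroup (hU.actsOn_O1.commute_Sz fun h0 => ?_)
  obtain ⟨b, hb, h0b⟩ := Finset.mem_biUnion.mp h0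
  exact h.zero_notMem_bar1 hγ hN hb h0b

theorem NonresonantWithin.conj_O2_Sz (h : NonresonantWithin N c Λ) (hN : 10 ≤ N) (hγ : 0 < c.γ)
    (hγ1 : c.γ ≤ 1) (hΓ : ∀ i, |c.Γ i| ≤ 1) (hU : IsStep1Rotation m₀ c Λ U)
    (hU' : IsStep2Rotation m₀ c Λ U U') :
    (O2 m₀ c Λ U U')ᵀ * Sz Λ 0 * O2 m₀ c Λ U U' = Sz Λ 0 := by
  refine conj_eq_of_commute hU'.O2_mem_orthogonalGroup (hU'.actsOn_O2.commute_Sz fun h0 => ?_)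
  obtain ⟨b, hb, h0b⟩ := Finset.mem_biUnion.mp h0
  exact h.zero_notMem_bar2 hγ hγ1 hΓ hU hN hb h0b

theorem NonresonantWithin.norm_conj_R2_Sz_sub_le (h : NonresonantWithin N c Λ) (hN : 10 ≤ N)
    (hγ : 0 < c.γ) (hγ1 : c.γ ≤ 1) (hΓ : ∀ i, |c.Γ i| ≤ 1) (hU : IsStep1Rotation m₀ c Λ U)
    (hU' : IsStep2Rotation m₀ c Λ U U') :
    ‖(R2 m₀ c Λ U U')ᵀ * Sz Λ 0 * R2 m₀ c Λ U U' - Sz Λ 0‖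
      ≤ 2 * (1 + (shortWords 2 (Finset.Icc (-4) 4)).card) * (c.γ / c.ε) := by
  have hΩ1 : ‖(Omega1 c Λ)ᵀ * Sz Λ 0 * Omega1 c Λ - Sz Λ 0‖ ≤ 2 * (c.γ / c.ε) :=
    (norm_exp_conj_sub_le (transpose_sum_A1 _) _).trans (norm_commutator_sum_A1_le hγ hΓ)
  have hΩ2 : ‖(Omega2 m₀ c Λ U)ᵀ * Sz Λ 0 * Omega2 m₀ c Λ U - Sz Λ 0‖
      ≤ (shortWords 2 (Finset.Icc (-4) 4)).card * (2 * (c.γ / c.ε)) :=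
    (norm_exp_conj_sub_le transpose_A2 _).trans
      (h.norm_commutator_A2_le (by omega) hγ hγ1 hΓ hU)
  have hΩO1 := norm_conj_mul_sub_le hU.O1_mem_orthogonalGroup (Omega1 c Λ) (Sz Λ 0)
  have hΩOΩ := norm_conj_mul_sub_le Omega2_mem_orthogonalGroup (U := Omega2 m₀ c Λ U)
    (Omega1 c Λ * O1 m₀ c Λ U) (Sz Λ 0)
  have hR := norm_conj_mul_sub_le hU'.O2_mem_orthogonalGroup
    (Omega1 c Λ * O1 m₀ c Λ U * Omega2 m₀ c Λ U) (Sz Λ 0)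
  rw [h.conj_O1_Sz (by omega) hγ hU, sub_self, norm_zero] at hΩO1
  rw [h.conj_O2_Sz hN hγ hγ1 hΓ hU hU', sub_self, norm_zero] at hR
  rw [R2]
  linarith

end CumulativeRotation

section Average

variable {Λ : Box} {p : Config Λ → ℝ} {R : Op Λ}

theorem averageSz_mem_Icc (hp : ∀ α, 0 ≤ p α) (hp1 : ∑ α, p α = 1)
    (hR : R ∈ Matrix.orthogonalGroup (Config Λ) ℝ) : averageSz p R ∈ Set.Icc 0 1 := by
  refine ⟨Finset.sum_nonneg fun α _ => mul_nonneg (hp α) (abs_nonneg _), ?_⟩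
  rw [averageSz, ← hp1]
  refine Finset.sum_le_sum fun α _ => mul_le_of_le_one_right (hp α) ?_
  exact (abs_entry_le_norm _ _ _).trans ((norm_conj_eq hR _).trans_le (norm_Sz_le_one 0))

theorem le_averageSz (hp : ∀ α, 0 ≤ p α) (hp1 : ∑ α, p α = 1) {δ : ℝ}
    (hR : ‖Rᵀ * Sz Λ 0 * R - Sz Λ 0‖ ≤ δ) : 1 - δ ≤ averageSz p R := by
  rw [averageSz, ← one_mul (1 - δ), ← hp1, Finset.sum_mul]
  refine Finset.sum_le_sum fun α _ => mul_le_mul_of_nonneg_left ?_ (hp α)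
  have hentry := (abs_entry_le_norm _ α α).trans hR
  rw [Matrix.sub_apply, abs_sub_comm] at hentry
  have hSz : |Sz Λ 0 α α| = 1 := by rw [Sz, Matrix.diagonal_apply_eq, abs_spin]
  linarith [abs_sub_abs_le_abs_sub (Sz Λ 0 α α) ((Rᵀ * Sz Λ 0 * R) α α)]

theorem aemeasurable_averageSz {Ω : Type*} [MeasurableSpace Ω] {μ : Measure Ω}
    {p : Ω → Config Λ → ℝ} {R : Ω → Op Λ} (hR : ∀ σ α, AEMeasurable (fun ω => R ω σ α) μ)
    (hp : ∀ α, AEMeasurable (fun ω => p ω α) μ) :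
    AEMeasurable (fun ω => averageSz (p ω) (R ω)) μ := by
  have hentry (ω : Ω) (α : Config Λ) :
      ((R ω)ᵀ * Sz Λ 0 * R ω) α α = ∑ σ, R ω σ α * spin σ 0 * R ω σ α := by
    rw [Matrix.mul_apply]
    simp only [Sz, Matrix.mul_diagonal, Matrix.transpose_apply]
  simp only [averageSz, hentry]
  exact Finset.aemeasurable_fun_sum _ fun α _ => (hp α).mul <| AEMeasurable.abs <|
    Finset.aemeasurable_fun_sum _ fun σ _ => ((hR σ α).mul_const _).mul (hR σ α)

end Average

end SpinChain

theorem proposition3p2_general (ρ₀ : ℝ) :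
    ∃ K : ℝ, ∀ (m₀ : ℕ) (Ω : Type*) [MeasurableSpace Ω] (μ : Measure Ω) [IsProbabilityMeasure μ]
      (V : SpinChain.RandomCouplings Ω) (γ : ℝ),
      SpinChain.IsDisorder μ ρ₀ V → 0 < γ → γ ≤ 1 →
      ∀ (Λ : SpinChain.Box) (U U' : Ω → Finset ℤ → SpinChain.Op Λ)
        (p : Ω → SpinChain.Config Λ → ℝ),
        (∀ᵐ ω ∂μ, SpinChain.IsStep1Rotation m₀ (V.at γ ω) Λ (U ω)) →
        (∀ᵐ ω ∂μ, SpinChain.IsStep2Rotation m₀ (V.at γ ω) Λ (U ω) (U' ω)) →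
        (∀ σ α, AEMeasurable
          (fun ω => SpinChain.R2 m₀ (V.at γ ω) Λ (U ω) (U' ω) σ α) μ) →
        (∀ α, AEMeasurable (fun ω => p ω α) μ) →
        (∀ᵐ ω ∂μ, (∀ α, 0 ≤ p ω α) ∧ ∑ α, p ω α = 1) →
        Integrable (fun ω => SpinChain.averageSz (p ω)
          (SpinChain.R2 m₀ (V.at γ ω) Λ (U ω) (U' ω))) μ ∧
        |∫ ω, SpinChain.averageSz (p ω)
          (SpinChain.R2 m₀ (V.at γ ω) Λ (U ω) (U' ω)) ∂μ - 1| ≤ K * γ ^ (1 / 20 : ℝ) := by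
  set A : ℝ := 2 * (1 + (SpinChain.shortWords 2 (Finset.Icc (-4) 4)).card)
  refine ⟨A + 2 ^ (4 * 10 + 6) * |ρ₀|,
    fun m₀ Ω _ μ _ V γ hV hγ hγ1 Λ U U' p hU hU' hR hp hp1 => ?_⟩
  set D : Set Ω := {ω | ¬SpinChain.NonresonantWithin 10 (V.at γ ω) Λ}
  have hD : MeasurableSet D := (SpinChain.measurableSet_nonresonantWithin hV 10 γ Λ).compl
  have hμD : μ.real D ≤ 2 ^ (4 * 10 + 6) * |ρ₀| * γ ^ (1 / 20 : ℝ) :=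
    ENNReal.toReal_le_of_le_ofReal (by positivity)
      (SpinChain.measure_not_nonresonantWithin_le hV 10 γ Λ)
  refine (SpinChain.abs_integral_sub_one_le (δ := A * γ ^ (1 / 20 : ℝ))
    (SpinChain.aemeasurable_averageSz hR hp) ?_ (by positivity) hD ?_).imp_right fun h =>
      h.trans ((add_le_add_right hμD _).trans_eq (add_mul _ _ _).symm)
  · filter_upwards [hp1, hU, hU'] with ω hpω hUω hUω'
    exact SpinChain.averageSz_mem_Icc hpω.1 hpω.2 (SpinChain.R2_mem_orthogonalGroup hUω hUω')
  · filter_upwards [hp1, hU, hU', ae_all_iff.mpr fun i => hV.bounded (1, i)]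
      with ω hpω hUω hUω' hΓ hω
    refine SpinChain.le_averageSz hpω.1 hpω.2 <|
      ((not_not.mp hω).norm_conj_R2_Sz_sub_le le_rfl hγ hγ1 hΓ hUω hUω').trans ?_
    exact mul_le_mul_of_nonneg_left
      (SpinChain.Couplings.γ_div_ε_le_ε (c := V.at γ ω) hγ hγ1) (by positivity)

theorem proposition3p2 (ρ₀ ν C : ℝ) (hν : 0 < ν) (m₀ : ℕ) (hm₀ : 0 < m₀) :
    ∃ K γ₀ : ℝ, 0 < γ₀ ∧
      ∀ (Ω : Type*) [MeasurableSpace Ω] (μ : Measure Ω) [IsProbabilityMeasure μ]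
        (V : SpinChain.RandomCouplings Ω) (γ : ℝ),
        SpinChain.IsDisorder μ ρ₀ V → 0 < γ → γ < γ₀ → SpinChain.LLA μ V γ ν C →
        ∀ (Λ : SpinChain.Box) (U U' : Ω → Finset ℤ → SpinChain.Op Λ)
          (p : Ω → SpinChain.Config Λ → ℝ),
          (∀ᵐ ω ∂μ, SpinChain.IsStep1Rotation m₀ (V.at γ ω) Λ (U ω)) →
          (∀ᵐ ω ∂μ, SpinChain.IsStep2Rotation m₀ (V.at γ ω) Λ (U ω) (U' ω)) →
          (∀ σ α, AEMeasurable
            (fun ω => SpinChain.R2 m₀ (V.at γ ω) Λ (U ω) (U' ω) σ α) μ) →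
          (∀ α, AEMeasurable (fun ω => p ω α) μ) →
          (∀ᵐ ω ∂μ, (∀ α, 0 ≤ p ω α) ∧ ∑ α, p ω α = 1) →
          Integrable (fun ω => SpinChain.averageSz (p ω)
            (SpinChain.R2 m₀ (V.at γ ω) Λ (U ω) (U' ω))) μ ∧
          |∫ ω, SpinChain.averageSz (p ω)
            (SpinChain.R2 m₀ (V.at γ ω) Λ (U ω) (U' ω)) ∂μ - 1| ≤ K * γ ^ (1 / 20 : ℝ) := by
  obtain ⟨K, hK⟩ := proposition3p2_general ρ₀
  exact ⟨K, 1, one_pos, fun Ω _ μ _ V γ hV hγ hγ1 _ => hK m₀ Ω μ V γ hV hγ hγ1.le⟩
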